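/- **Setting.** Space-time is $\mathbb R\times\mathbb R^3$, points are $z=(t,x)=(z_0,\dots,z_3)$; $\mathfrak s=(2,1,1,1)$, $|z|=\max_i|z_i|^{1/\mathfrak s_i}$, $B(0,1)=\{|z|<1\}$, and $|k|=\sum_i\mathfrak s_ik_i$, $k!=\prod_i k_i!$ for $k\in\mathbb N^4$. The torus $\mathbb T^3=\mathbb R^3/\mathbb Z^3$ has size one; functions on $(0,T)\times\mathbb T^3$ are identified with functions on $(0,T)\times\mathbb R^3$ that are $\mathbb Z^3$-periodic in $x$. Let $\mathcal T=\bigoplus_{\zeta\in\mathcal A}\mathcal T_\zeta$ be the graded space of finite real linear combinations of the symbols in $\mathcal F=\mathcal U\cup\mathcal R_U\cup\mathcal W\cup\mathcal R_W$, where $\mathcal U,\mathcal R_U,\mathcal W,\mathcal R_W$ are the smallest sets of symbols (built with a commutative, associative product with unit $1=X^0$) such that: each of them contains all $X^k$, $k\in\mathbb N^4$; $\Xi\in\mathcal R_U$; $\tau_1,\tau_2,\tau_3\in\mathcal U\Rightarrow\tau_1\tau_2\tau_3\in\mathcal R_U$; $\tau\in\mathcal R_U\Rightarrow\mathcal I(\tau)\in\mathcal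 U$; $\tau_1,\tau_2\in\mathcal U,\ \rho\in\mathcal W\Rightarrow\tau_1\tau_2\rho\in\mathcal R_W$; $\tau\in\mathcal R_W\Rightarrow\tilde{\mathcal I}(\tau)\in\mathcal W$; with the convention $\mathcal I(X^k)=\tilde{\mathcal I}(X^k)=0$. The homogeneities are $|X^k|=|k|$, $|\Xi|=\theta$ for a fixed $\theta\in\mathbb R$, $|\mathcal I(\tau)|=|\tilde{\mathcal I}(\tau)|=|\tau|+2$, $|\tau_1\tau_2|=|\tau_1|+|\tau_2|$; $\mathcal A$ is the set of homogeneities of the symbols in $\mathcal F$, $\mathcal T_{<\gamma}=\bigoplus_{\zeta<\gamma}\mathcal T_\zeta$, and $|\tau|_\zeta$ is the $\ell^1$-norm of the coefficients of the component of $\tau$ in $\mathcal T_\zeta$. The structure group $\mathcal G$ consists of the restrictions to $\mathcal T$ of the automorphisms $\Gamma$ of the algebra spanned by all symbols such that, for some $c\in\mathbb R^4$, $\Gamma X_i=X_i+c_i1$ $(0\le i\le3)$, $\Gamma\Xi=\Xi$, the elements $\Gamma\mathcal I(\tau)-\mathcal I(\Gamma\tau)$ and $\Gamma\tilde{\mathcal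 I}(\tau)-\tilde{\mathcal I}(\Gamma\tau)$ are linear combinations of $X^k$ with $|k|<|\tau|+2$, and $\Gamma\tau-\tau$, $\Gamma^{-1}\tau-\tau$ are combinations of symbols of homogeneity $<|\tau|$, for every symbol $\tau$. Let $r>5/2$ be an integer. A model $(\Pi,\Gamma)$ consists of linear maps $\Pi_z:\mathcal T\to\mathcal D'(\mathbb R^4)$ and elements $\Gamma_{z,z'}\in\mathcal G$ with $\Pi_z\Gamma_{z,z'}=\Pi_{z'}$ and $\Pi_zX^k=(\cdot-z)^k$ such that, for every bounded $K\subset\mathbb R^4$ and every $\gamma\in\mathbb R$, there is $C$ with $$|\langle\Pi_z\tau,\varphi^\lambda_z\rangle|\le C|\tau|_\zeta\lambda^\zeta,\qquad |\Gamma_{z,z'}\tau|_\nu\le C|\tau|_\zeta|z-z'|^{\zeta-\nu}$$ for all $z,z'\in K$ (with $|z-z'|\le1$ in the second bound), $\lambda\in(0,1]$, $\nu\le\zeta<\gamma$ in $\mathcal A$, $\tau\in\mathcal T_\zeta$, and all smooth $\varphi$ supported in $\{|y|\le1\}$ with $|\partial^k\varphi|\le1$ for $|k|<r$; here $\varphi_z^\lambda(y)=\lambda^{-5}\varphi\big((\lambda^{-\mathfrak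 s_i}(y_i-z_i))_i\big)$. (Nothing is required of $\Pi_z\mathcal I\tau$ and $\Pi_z\tilde{\mathcal I}\tau$, so that in particular all admissible models are covered.) For $T>0$, $\eta\le\gamma$ and $p\in[1,\infty]$, $\mathcal D^{\gamma,\eta,T}_p$ is the space of all measurable periodic maps $f:(0,T)\times\mathbb R^3\to\mathcal T_{<\gamma}$ such that for all $\zeta\in\mathcal A$ with $\zeta<\gamma$ $$\Big\|\frac{|f(z)|_\zeta}{t^{(\eta-\zeta)/2}}\Big\|_{L^p((0,T)\times\mathbb T^3,dz)}<\infty,\qquad \sup_{h\in B(0,1)}\Big\|\frac{|f(z+h)-\Gamma_{z+h,z}f(z)|_\zeta}{|h|^{\gamma-\zeta}\,t^{(\eta-\gamma)/2}}\Big\|_{L^p((3|h|^2,T-|h|^2)\times\mathbb T^3,dz)}<\infty .$$ Let $P(t,x)=\mathbf 1_{t>0}(4\pi t)^{-3/2}e^{-|x|^2/(4t)}$ be the heat kernel. For $h\in L^2((0,T)\times\mathbb T^3)$ set $$\mathcal Ph(z)=\sum_{|k|<2}\frac{X^k}{k!}\,\langle h,\partial^kP(z-\cdot)\rangle,\qquad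 \langle h,\partial^kP(z-\cdot)\rangle=\int_{(0,T)\times\mathbb R^3}h(w)\,\partial^kP(z-w)\,dw .$$ **Lemma.** Let $(\Pi,\Gamma)$ be any model, $T>0$, $h\in L^2((0,T)\times\mathbb T^3)$ and $\kappa>0$. Then for almost every $z\in(0,T)\times\mathbb R^3$ the integrals defining $\mathcal Ph(z)$ converge absolutely, and the restriction (projection) of $\mathcal Ph$ to $\mathcal T_{<2-\kappa}$ is an element of $\mathcal D^{2-\kappa,2-\kappa,T}_2$ (with respect to the given model). -/

import Mathlib

open MeasureTheory Set
open scoped ENNReal Distributions ContDiff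

noncomputable section

namespace ConvShift

/-! ### Space-time, parabolic scaling, multi-indices -/

/-- Space-time `ℝ × ℝ³`; coordinate `0` is time, coordinates `1, 2, 3` are space. -/
abbrev Spacetime : Type := Fin 4 → ℝ

abbrev MultiIndex : Type := Fin 4 → ℕ

/-- The parabolic scaling `𝔰 = (2, 1, 1, 1)`. -/
def scaling : Fin 4 → ℕ := ![2, 1, 1, 1]

/-- The scaled degree `|k| = ∑ 𝔰ᵢ kᵢ` of a multi-index. -/
def MultiIndex.deg (k : MultiIndex) : ℕ := ∑ i, scaling i * k i

/-- `k! = ∏ kᵢ!`. -/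
def MultiIndex.fact (k : MultiIndex) : ℕ := ∏ i, (k i).factorial

/-- `z^k = ∏ zᵢ^{kᵢ}`. -/
def monomial (z : Spacetime) (k : MultiIndex) : ℝ := ∏ i, z i ^ k i

/-- The scaled norm `|z| = maxᵢ |zᵢ|^{1/𝔰ᵢ}`. -/
def scaledNorm (z : Spacetime) : ℝ :=
  Finset.univ.sup' Finset.univ_nonempty fun i => |z i| ^ (1 / (scaling i : ℝ))

/-- The partial derivative in the coordinate `i`. -/
def partialD (i : Fin 4) (f : Spacetime → ℝ) : Spacetime → ℝ :=
  fun z => lineDeriv ℝ f z (Pi.single i 1)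

/-- `∂^k = ∂₀^{k₀} ∂₁^{k₁} ∂₂^{k₂} ∂₃^{k₃}`. -/
def iterPartialD (k : MultiIndex) (f : Spacetime → ℝ) : Spacetime → ℝ :=
  (partialD 0)^[k 0] ((partialD 1)^[k 1] ((partialD 2)^[k 2] ((partialD 3)^[k 3] f)))

/-- The space-time vector `(0, n)`, for `n ∈ ℤ³`. -/
def latticeShift (n : Fin 3 → ℤ) : Spacetime := Fin.cons 0 fun i => (n i : ℝ)

/-- `(0, T) × ℝ³`. -/
def strip (T : ℝ) : Set Spacetime := {z | 0 < z 0 ∧ z 0 < T}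

/-- `(a, b) × 𝕋³`, where `𝕋³` (of size one) is represented by the fundamental domain `[0, 1)³`. -/
def torusSlab (a b : ℝ) : Set Spacetime :=
  {z | a < z 0 ∧ z 0 < b ∧ ∀ i : Fin 3, 0 ≤ z i.succ ∧ z i.succ < 1}

/-- `f` is periodic in space on `(0, T) × ℝ³`. -/
def IsPeriodic {E : Type*} (T : ℝ) (f : Spacetime → E) : Prop :=
  ∀ z ∈ strip T, ∀ n : Fin 3 → ℤ, f (z + latticeShift n) = f z

/-! ### The symbols -/

/-- Formal expressions, before identification of the order and bracketing of products. -/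
inductive Expr : Type
  | one : Expr
  | X : Fin 4 → Expr
  | Xi : Expr
  | I : Expr → Expr
  | J : Expr → Expr
  | mul : Expr → Expr → Expr

/-- The congruence making the product commutative and associative with unit `one`. -/
inductive Expr.Equiv : Expr → Expr → Prop
  | refl (a) : Expr.Equiv a a
  | symm {a b} : Expr.Equiv a b → Expr.Equiv b a
  | trans {a b c} : Expr.Equiv a b → Expr.Equiv b c → Expr.Equiv a c
  | mul_comm (a b) : Expr.Equiv (.mul a b) (.mul b a)
  | mul_assoc (a b c) : Expr.Equiv (.mul (.mul a b) c) (.mul a (.mul b c))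
  | one_mul (a) : Expr.Equiv (.mul .one a) a
  | mul_congr {a a' b b'} : Expr.Equiv a a' → Expr.Equiv b b' →
      Expr.Equiv (.mul a b) (.mul a' b')
  | I_congr {a a'} : Expr.Equiv a a' → Expr.Equiv (.I a) (.I a')
  | J_congr {a a'} : Expr.Equiv a a' → Expr.Equiv (.J a) (.J a')

instance Expr.setoid : Setoid Expr :=
  ⟨Expr.Equiv, Expr.Equiv.refl, Expr.Equiv.symm, Expr.Equiv.trans⟩

/-- All symbols built from `1, X₀, …, X₃, Ξ`, the abstract integration maps `𝓘` (heat kernel) and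
`𝓘̃` (backward heat kernel), and a commutative, associative, unital product. -/
def Symb : Type := Quotient Expr.setoid

namespace Symb

def X (i : Fin 4) : Symb := Quotient.mk _ (.X i)

def Xi : Symb := Quotient.mk _ .Xi

/-- The symbol `𝓘(τ)`. -/
def I : Symb → Symb := Quotient.map Expr.I fun _ _ h => .I_congr h

/-- The symbol `𝓘̃(τ)`. -/
def J : Symb → Symb := Quotient.map Expr.J fun _ _ h => .J_congr h

instance : CommMonoid Symb where
  mul := Quotient.map₂ Expr.mul fun _ _ h _ _ h' => .mul_congr h h'
  one := Quotient.mk _ .one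
  mul_assoc := by
    rintro ⟨a⟩ ⟨b⟩ ⟨c⟩
    exact Quotient.sound (.mul_assoc a b c)
  mul_comm := by
    rintro ⟨a⟩ ⟨b⟩
    exact Quotient.sound (.mul_comm a b)
  one_mul := by
    rintro ⟨a⟩
    exact Quotient.sound (.one_mul a)
  mul_one := by
    rintro ⟨a⟩
    exact Quotient.sound ((Expr.Equiv.mul_comm a .one).trans (.one_mul a))

/-- The symbol `X^k`. -/
def Xpow (k : MultiIndex) : Symb := ∏ i, X i ^ k i

/-- `τ` is one of the polynomial symbols `X^k`. -/
def IsPoly (τ : Symb) : Prop := ∃ k, τ = Xpow k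

end Symb

/-- Homogeneity of expressions, when `|Ξ| = θ`. -/
def Expr.hom (θ : ℝ) : Expr → ℝ
  | .one => 0
  | .X i => scaling i
  | .Xi => θ
  | .I a => a.hom θ + 2
  | .J a => a.hom θ + 2
  | .mul a b => a.hom θ + b.hom θ

/-- The homogeneity `|τ|` of a symbol, when `|Ξ| = θ`. -/
def Symb.hom (θ : ℝ) : Symb → ℝ :=
  Quotient.lift (Expr.hom θ) fun a b h => by
    change Expr.Equiv a b at h
    induction h with
    | refl => rfl
    | symm _ ih => exact ih.symm
    | trans _ _ ih ih' => exact ih.trans ih'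
    | mul_comm a b => exact add_comm _ _
    | mul_assoc a b c => exact add_assoc _ _ _
    | one_mul a => exact zero_add _
    | mul_congr _ _ ih ih' => simp only [Expr.hom, ih, ih']
    | I_congr _ ih => simp only [Expr.hom, ih]
    | J_congr _ ih => simp only [Expr.hom, ih]

/-! The sets of symbols `𝓤`, `𝓡_U`, `𝓦`, `𝓡_W`. Since `𝓘(X^k) = 𝓘̃(X^k) = 0`, these expressions do
not count as symbols. -/

mutual
inductive IsU : Symb → Prop
  | poly (k : MultiIndex) : IsU (.Xpow k)
  | I {τ : Symb} : IsRU τ → ¬ τ.IsPoly → IsU (.I τ)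
inductive IsRU : Symb → Prop
  | poly (k : MultiIndex) : IsRU (.Xpow k)
  | Xi : IsRU .Xi
  | mul {τ₁ τ₂ τ₃ : Symb} : IsU τ₁ → IsU τ₂ → IsU τ₃ → IsRU (τ₁ * τ₂ * τ₃)
end

mutual
inductive IsW : Symb → Prop
  | poly (k : MultiIndex) : IsW (.Xpow k)
  | J {τ : Symb} : IsRW τ → ¬ τ.IsPoly → IsW (.J τ)
inductive IsRW : Symb → Prop
  | poly (k : MultiIndex) : IsRW (.Xpow k)
  | mul {τ₁ τ₂ ρ : Symb} : IsU τ₁ → IsU τ₂ → IsW ρ → IsRW (τ₁ * τ₂ * ρ)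
end

/-- The set of symbols `𝓕 = 𝓤 ∪ 𝓡_U ∪ 𝓦 ∪ 𝓡_W`. -/
def symbols : Set Symb := {τ | IsU τ ∨ IsRU τ ∨ IsW τ ∨ IsRW τ}

/-! ### The graded space `𝓣` -/

/-- `𝓣`: formal (finite) linear combinations of the symbols in `𝓕`. -/
abbrev ModelSpace : Type := symbols →₀ ℝ

/-- The polynomial symbol `X^k` as an element of `𝓕`. -/
def polySymbol (k : MultiIndex) : symbols := ⟨.Xpow k, Or.inl (.poly k)⟩

/-- The basis vector `X^k` of `𝓣`. -/
def polyVec (k : MultiIndex) : ModelSpace := Finsupp.single (polySymbol k) 1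

/-- The set of homogeneities `𝓐`. -/
def homogeneities (θ : ℝ) : Set ℝ := {ζ | ∃ τ ∈ symbols, τ.hom θ = ζ}

/-- `|τ|_ζ`: the (ℓ¹) norm of the component of `τ` in `𝓣_ζ`. -/
def levelNorm (θ ζ : ℝ) (τ : ModelSpace) : ℝ :=
  ∑ σ ∈ τ.support with σ.1.hom θ = ζ, |τ σ|

open Classical in
/-- The projection `𝓠_{<γ}` of `𝓣` onto `𝓣_{<γ}`. -/
def projBelow (θ γ : ℝ) (τ : ModelSpace) : ModelSpace := τ.filter fun σ => σ.1.hom θ < γ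

/-- `τ ∈ 𝓣_ζ`. -/
def AtLevel (θ ζ : ℝ) (τ : ModelSpace) : Prop := ∀ σ ∈ τ.support, σ.1.hom θ = ζ

/-- `τ ∈ 𝓣_{<γ}`. -/
def BelowLevel (θ γ : ℝ) (τ : ModelSpace) : Prop := ∀ σ ∈ τ.support, σ.1.hom θ < γ

/-! ### The structure group -/

/-- The commutative algebra of linear combinations of all symbols, in which `𝓣` sits. -/
abbrev SymbAlg : Type := MonoidAlgebra ℝ Symb

/-- A symbol as an element of the algebra. -/
def gen (τ : Symb) : SymbAlg := MonoidAlgebra.single τ 1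

/-- The inclusion of `𝓣` in the algebra of all symbols. -/
def incl : ModelSpace →ₗ[ℝ] SymbAlg := Finsupp.linearCombination ℝ fun σ : symbols => gen σ.1

open Classical in
/-- The linear map `𝓘`, with `𝓘(X^k) = 0`. -/
def intI : SymbAlg →ₗ[ℝ] SymbAlg :=
  Finsupp.linearCombination ℝ (fun τ : Symb => if τ.IsPoly then 0 else gen τ.I) ∘ₗ
    (MonoidAlgebra.coeffLinearEquiv ℝ).toLinearMap

open Classical in
/-- The linear map `𝓘̃`, with `𝓘̃(X^k) = 0`. -/
def intJ : SymbAlg →ₗ[ℝ] SymbAlg :=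
  Finsupp.linearCombination ℝ (fun τ : Symb => if τ.IsPoly then 0 else gen τ.J) ∘ₗ
    (MonoidAlgebra.coeffLinearEquiv ℝ).toLinearMap

/-- Polynomials of scaled degree less than `m`. -/
def polyBelow (m : ℝ) : Submodule ℝ SymbAlg :=
  Submodule.span ℝ {x | ∃ k : MultiIndex, (k.deg : ℝ) < m ∧ x = gen (.Xpow k)}

/-- Linear combinations of symbols of homogeneity less than `m`. -/
def algBelow (θ m : ℝ) : Submodule ℝ SymbAlg :=
  Submodule.span ℝ {x | ∃ τ : Symb, τ.hom θ < m ∧ x = gen τ}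

/-- The algebra automorphisms that define the structure group: `X` is translated, `Ξ` is fixed,
`𝓘` and `𝓘̃` are commuted with up to polynomials of degree less than `|τ| + 2`, and the grading is
respected in the triangular sense `Φτ - τ ∈ 𝓣_{<|τ|}`. -/
structure IsStructural (θ : ℝ) (Φ : SymbAlg ≃ₐ[ℝ] SymbAlg) : Prop where
  map_X : ∃ c : Spacetime, ∀ i, Φ (gen (.X i)) = gen (.X i) + algebraMap ℝ SymbAlg (c i)
  map_Xi : Φ (gen .Xi) = gen .Xi
  map_I : ∀ τ : Symb, Φ (intI (gen τ)) - intI (Φ (gen τ)) ∈ polyBelow (τ.hom θ + 2)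
  map_J : ∀ τ : Symb, Φ (intJ (gen τ)) - intJ (Φ (gen τ)) ∈ polyBelow (τ.hom θ + 2)
  upper : ∀ τ : Symb, Φ (gen τ) - gen τ ∈ algBelow θ (τ.hom θ)
  upper_symm : ∀ τ : Symb, Φ.symm (gen τ) - gen τ ∈ algBelow θ (τ.hom θ)

lemma gen_mul (σ τ : Symb) : gen (σ * τ) = gen σ * gen τ := by
  simp [gen, MonoidAlgebra.single_mul_single]

lemma gen_one : gen 1 = 1 := rfl

lemma gen_Xpow (k : MultiIndex) : gen (.Xpow k) = ∏ i, gen (.X i) ^ k i := by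
  have h : ∀ τ, gen τ = MonoidAlgebra.of ℝ Symb τ := fun _ => rfl
  simp only [Symb.Xpow, h, map_prod, map_pow]

lemma polyBelow_mono {m n : ℝ} (h : m ≤ n) : polyBelow m ≤ polyBelow n :=
  Submodule.span_mono fun _ ⟨k, hk, e⟩ => ⟨k, hk.trans_le h, e⟩

lemma algBelow_mono {θ m n : ℝ} (h : m ≤ n) : algBelow θ m ≤ algBelow θ n :=
  Submodule.span_mono fun _ ⟨k, hk, e⟩ => ⟨k, hk.trans_le h, e⟩

/-- Polynomials of scaled degree at most `n`. -/
def polyLE (n : ℕ) : Submodule ℝ SymbAlg :=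
  Submodule.span ℝ {x | ∃ k : MultiIndex, k.deg ≤ n ∧ x = gen (.Xpow k)}

lemma polyLE_mul {a b : ℕ} {x y : SymbAlg} (hx : x ∈ polyLE a) (hy : y ∈ polyLE b) :
    x * y ∈ polyLE (a + b) := by
  have h := Submodule.mul_mem_mul hx hy
  rw [polyLE, polyLE, Submodule.span_mul_span] at h
  refine Submodule.span_mono ?_ h
  rintro _ ⟨_, ⟨k, hk, rfl⟩, _, ⟨l, hl, rfl⟩, rfl⟩
  refine ⟨k + l, ?_, ?_⟩
  · have : (k + l : MultiIndex).deg = k.deg + l.deg := by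
      simp [MultiIndex.deg, mul_add, Finset.sum_add_distrib]
    change (k + l : MultiIndex).deg ≤ _
    omega
  · simp [gen_Xpow, pow_add, Finset.prod_mul_distrib]

lemma algebraMap_mem_polyLE (c : ℝ) (n : ℕ) : algebraMap ℝ SymbAlg c ∈ polyLE n := by
  rw [Algebra.algebraMap_eq_smul_one]
  refine Submodule.smul_mem _ _ (Submodule.subset_span ⟨0, ?_, ?_⟩)
  · simp [MultiIndex.deg]
  · simp [gen_Xpow]

lemma polyLE_pow {a : ℕ} {x : SymbAlg} (hx : x ∈ polyLE a) (n : ℕ) :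
    x ^ n ∈ polyLE (a * n) := by
  induction n with
  | zero => simpa only [pow_zero, mul_zero, Finset.prod_empty, Finset.sum_empty, map_one] using
    algebraMap_mem_polyLE 1 0
  | succ n ih => rw [pow_succ, Nat.mul_succ]; exact polyLE_mul ih hx

lemma gen_X_mem_polyLE (i : Fin 4) : gen (.X i) ∈ polyLE (scaling i) := by
  refine Submodule.subset_span ⟨Pi.single i 1, ?_, ?_⟩
  · simp [MultiIndex.deg, Pi.single_apply]
  · simp [gen_Xpow, Pi.single_apply, pow_ite]

lemma translate_Xpow_mem (Φ : SymbAlg ≃ₐ[ℝ] SymbAlg) (c : Spacetime)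
    (hc : ∀ i, Φ (gen (.X i)) = gen (.X i) + algebraMap ℝ SymbAlg (c i)) (k : MultiIndex) :
    Φ (gen (.Xpow k)) ∈ polyLE k.deg := by
  rw [gen_Xpow, map_prod, MultiIndex.deg]
  induction (Finset.univ : Finset (Fin 4)) using Finset.induction_on with
  | empty => simpa only [pow_zero, mul_zero, Finset.prod_empty, Finset.sum_empty, map_one] using
    algebraMap_mem_polyLE 1 0
  | insert i s hi ih =>
    rw [Finset.prod_insert hi, Finset.sum_insert hi]
    refine polyLE_mul ?_ ih
    rw [map_pow, hc]
    exact polyLE_pow (add_mem (gen_X_mem_polyLE i) (algebraMap_mem_polyLE _ _)) _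

lemma translate_polyBelow (Φ : SymbAlg ≃ₐ[ℝ] SymbAlg)
    (h : ∃ c : Spacetime, ∀ i, Φ (gen (.X i)) = gen (.X i) + algebraMap ℝ SymbAlg (c i))
    {m : ℝ} {x : SymbAlg} (hx : x ∈ polyBelow m) : Φ x ∈ polyBelow m := by
  obtain ⟨c, hc⟩ := h
  induction hx using Submodule.span_induction with
  | mem x hx =>
    obtain ⟨k, hk, rfl⟩ := hx
    refine (Submodule.span_mono ?_ : polyLE k.deg ≤ polyBelow m) (translate_Xpow_mem Φ c hc k)
    rintro _ ⟨l, hl, rfl⟩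
    exact ⟨l, lt_of_le_of_lt (by exact_mod_cast hl) hk, rfl⟩
  | zero => simp
  | add x y _ _ hx hy => rw [map_add]; exact add_mem hx hy
  | smul a x _ hx => rw [map_smul]; exact Submodule.smul_mem _ _ hx

lemma upper_algBelow {θ : ℝ} (Φ : SymbAlg ≃ₐ[ℝ] SymbAlg)
    (h : ∀ τ : Symb, Φ (gen τ) - gen τ ∈ algBelow θ (τ.hom θ))
    {m : ℝ} {x : SymbAlg} (hx : x ∈ algBelow θ m) : Φ x ∈ algBelow θ m := by
  induction hx using Submodule.span_induction with
  | mem x hx =>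
    obtain ⟨τ, hτ, rfl⟩ := hx
    have := add_mem (algBelow_mono hτ.le (h τ)) (Submodule.subset_span ⟨τ, hτ, rfl⟩)
    simpa using this
  | zero => simp
  | add x y _ _ hx hy => rw [map_add]; exact add_mem hx hy
  | smul a x _ hx => rw [map_smul]; exact Submodule.smul_mem _ _ hx

lemma commutator_algBelow {θ : ℝ} (Φ : SymbAlg ≃ₐ[ℝ] SymbAlg) (A : SymbAlg →ₗ[ℝ] SymbAlg)
    (h : ∀ τ : Symb, Φ (A (gen τ)) - A (Φ (gen τ)) ∈ polyBelow (τ.hom θ + 2))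
    {m : ℝ} {x : SymbAlg} (hx : x ∈ algBelow θ m) :
    Φ (A x) - A (Φ x) ∈ polyBelow (m + 2) := by
  induction hx using Submodule.span_induction with
  | mem x hx =>
    obtain ⟨τ, hτ, rfl⟩ := hx
    exact polyBelow_mono (by linarith) (h τ)
  | zero => simp
  | add x y _ _ hx hy =>
    simp only [map_add, add_sub_add_comm]
    exact add_mem hx hy
  | smul a x _ hx =>
    simp only [map_smul, ← smul_sub]
    exact Submodule.smul_mem _ _ hx

lemma commutator_gen_add {θ : ℝ} (Φ : SymbAlg ≃ₐ[ℝ] SymbAlg) (A : SymbAlg →ₗ[ℝ] SymbAlg)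
    (h : ∀ τ : Symb, Φ (A (gen τ)) - A (Φ (gen τ)) ∈ polyBelow (τ.hom θ + 2))
    (τ : Symb) {y : SymbAlg} (hy : y - gen τ ∈ algBelow θ (τ.hom θ)) :
    Φ (A y) - A (Φ y) ∈ polyBelow (τ.hom θ + 2) := by
  have := add_mem (h τ) (commutator_algBelow Φ A h hy)
  simp only [map_sub] at this
  convert this using 1
  abel

lemma IsStructural.one (θ : ℝ) : IsStructural θ 1 where
  map_X := ⟨0, by simp⟩
  map_Xi := rfl
  map_I := by simp
  map_J := by simp
  upper := by simp
  upper_symm τ := by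
    rw [show (1 : SymbAlg ≃ₐ[ℝ] SymbAlg).symm (gen τ) = gen τ from rfl, sub_self]
    exact zero_mem _

lemma IsStructural.symm {θ : ℝ} {Φ : SymbAlg ≃ₐ[ℝ] SymbAlg} (h : IsStructural θ Φ) :
    IsStructural θ Φ.symm := by
  have hX : ∃ c : Spacetime, ∀ i,
      Φ.symm (gen (.X i)) = gen (.X i) + algebraMap ℝ SymbAlg (c i) := by
    obtain ⟨c, hc⟩ := h.map_X
    refine ⟨-c, fun i => ?_⟩
    rw [AlgEquiv.symm_apply_eq, map_add, hc, AlgEquiv.commutes]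
    simp
  have key : ∀ A : SymbAlg →ₗ[ℝ] SymbAlg,
      (∀ τ : Symb, Φ (A (gen τ)) - A (Φ (gen τ)) ∈ polyBelow (τ.hom θ + 2)) → ∀ τ : Symb,
      Φ.symm (A (gen τ)) - A (Φ.symm (gen τ)) ∈ polyBelow (τ.hom θ + 2) := by
    intro A hA τ
    have h1 := commutator_gen_add Φ A hA τ (h.upper_symm τ)
    have h2 := neg_mem (translate_polyBelow Φ.symm hX h1)
    simpa using h2
  exact ⟨hX, by rw [AlgEquiv.symm_apply_eq, h.map_Xi], key _ h.map_I, key _ h.map_J,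
    h.upper_symm, h.upper⟩

lemma upper_comp {θ : ℝ} (Φ Ψ : SymbAlg ≃ₐ[ℝ] SymbAlg)
    (h : ∀ τ : Symb, Φ (gen τ) - gen τ ∈ algBelow θ (τ.hom θ))
    (h' : ∀ τ : Symb, Ψ (gen τ) - gen τ ∈ algBelow θ (τ.hom θ)) (τ : Symb) :
    Φ (Ψ (gen τ)) - gen τ ∈ algBelow θ (τ.hom θ) := by
  have h1 := add_mem (upper_algBelow Φ h (h' τ)) (h τ)
  rwa [map_sub, sub_add_sub_cancel] at h1

lemma commutator_comp {θ : ℝ} {Φ Ψ : SymbAlg ≃ₐ[ℝ] SymbAlg} (h : IsStructural θ Φ)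
    (h' : IsStructural θ Ψ) (A : SymbAlg →ₗ[ℝ] SymbAlg)
    (hA : ∀ τ : Symb, Φ (A (gen τ)) - A (Φ (gen τ)) ∈ polyBelow (τ.hom θ + 2))
    (hA' : ∀ τ : Symb, Ψ (A (gen τ)) - A (Ψ (gen τ)) ∈ polyBelow (τ.hom θ + 2)) (τ : Symb) :
    Φ (Ψ (A (gen τ))) - A (Φ (Ψ (gen τ))) ∈ polyBelow (τ.hom θ + 2) := by
  have h1 := add_mem (translate_polyBelow Φ h.map_X (hA' τ))
    (commutator_gen_add Φ A hA τ (h'.upper τ))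
  rwa [map_sub, sub_add_sub_cancel] at h1

lemma IsStructural.mul {θ : ℝ} {Φ Ψ : SymbAlg ≃ₐ[ℝ] SymbAlg} (h : IsStructural θ Φ)
    (h' : IsStructural θ Ψ) : IsStructural θ (Ψ.trans Φ) where
  map_X := by
    obtain ⟨c, hc⟩ := h.map_X
    obtain ⟨c', hc'⟩ := h'.map_X
    refine ⟨c + c', fun i => ?_⟩
    rw [AlgEquiv.trans_apply, hc', map_add, hc, AlgEquiv.commutes, Pi.add_apply, map_add,
      add_assoc]
  map_Xi := by rw [AlgEquiv.trans_apply, h'.map_Xi, h.map_Xi]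
  map_I τ := by
    rw [AlgEquiv.trans_apply, AlgEquiv.trans_apply]
    exact commutator_comp h h' intI h.map_I h'.map_I τ
  map_J τ := by
    rw [AlgEquiv.trans_apply, AlgEquiv.trans_apply]
    exact commutator_comp h h' intJ h.map_J h'.map_J τ
  upper τ := by
    rw [AlgEquiv.trans_apply]
    exact upper_comp Φ Ψ h.upper h'.upper τ
  upper_symm τ := by
    rw [AlgEquiv.symm_trans_apply]
    exact upper_comp Ψ.symm Φ.symm h'.upper_symm h.upper_symm τ

/-- The structure group `𝓖` (when `|Ξ| = θ`), acting on `𝓣`: the restrictions to `𝓣` of the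
automorphisms described in `IsStructural`. -/
def structureGroup (θ : ℝ) : Subgroup (ModelSpace ≃ₗ[ℝ] ModelSpace) where
  carrier := {Γ | ∃ Φ : SymbAlg ≃ₐ[ℝ] SymbAlg, IsStructural θ Φ ∧
    ∀ τ, incl (Γ τ) = Φ (incl τ)}
  mul_mem' := by
    rintro Γ Γ' ⟨Φ, h, e⟩ ⟨Φ', h', e'⟩
    exact ⟨Φ'.trans Φ, h.mul h', fun τ => by simp [e, e']⟩
  one_mem' := ⟨1, .one θ, fun _ => rfl⟩
  inv_mem' := by
    rintro Γ ⟨Φ, h, e⟩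
    refine ⟨Φ.symm, h.symm, fun τ => ?_⟩
    rw [AlgEquiv.eq_symm_apply, ← e]
    exact congrArg incl (Γ.apply_symm_apply τ)

/-! ### Models -/

/-- Smooth functions in `𝓑^r`: supported in the scaled unit ball and with all derivatives of
scaled order `< r` bounded by one. -/
def IsUnitTest (r : ℕ) (φ : Spacetime → ℝ) : Prop :=
  ContDiff ℝ ∞ φ ∧ (∀ y, φ y ≠ 0 → scaledNorm y ≤ 1) ∧
    ∀ k : MultiIndex, k.deg < r → ∀ y, |iterPartialD k φ y| ≤ 1

/-- `φ^λ_z(y) = λ^{-|𝔰|} φ(λ^{-1} · (y - z))`, where `|𝔰| = 5`. -/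
def rescale (lam : ℝ) (z : Spacetime) (φ : Spacetime → ℝ) : Spacetime → ℝ :=
  fun y => (lam ^ 5)⁻¹ * φ fun i => (lam ^ scaling i)⁻¹ * (y i - z i)

/-- A model `(Π, Γ)` for the regularity structure `(𝓐, 𝓣, 𝓖)` with `|Ξ| = θ`, which acts on
polynomials in the canonical way. -/
structure Model (θ : ℝ) (r : ℕ) where
  Pi : Spacetime → ModelSpace →ₗ[ℝ] 𝓓'((⊤ : TopologicalSpace.Opens Spacetime), ℝ)
  Gam : Spacetime → Spacetime → structureGroup θ
  bound_Pi : ∀ K : Set Spacetime, Bornology.IsBounded K → ∀ γ : ℝ, ∃ C : ℝ,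
    ∀ z ∈ K, ∀ lam : ℝ, 0 < lam → lam ≤ 1 → ∀ ζ ∈ homogeneities θ, ζ < γ →
    ∀ τ, AtLevel θ ζ τ → ∀ φ, IsUnitTest r φ →
    ∀ ψ : 𝓓((⊤ : TopologicalSpace.Opens Spacetime), ℝ), (ψ : Spacetime → ℝ) = rescale lam z φ →
      |Pi z τ ψ| ≤ C * levelNorm θ ζ τ * lam ^ ζ
  bound_Gam : ∀ K : Set Spacetime, Bornology.IsBounded K → ∀ γ : ℝ, ∃ C : ℝ,
    ∀ z ∈ K, ∀ z' ∈ K, scaledNorm (z - z') ≤ 1 →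
    ∀ ζ ∈ homogeneities θ, ζ < γ → ∀ ν ∈ homogeneities θ, ν ≤ ζ → ∀ τ, AtLevel θ ζ τ →
      levelNorm θ ν ((Gam z z').1 τ) ≤ C * levelNorm θ ζ τ * scaledNorm (z - z') ^ (ζ - ν)
  Pi_Gam : ∀ z z' τ, Pi z ((Gam z z').1 τ) = Pi z' τ
  Pi_poly : ∀ z (k : MultiIndex) (ψ : 𝓓((⊤ : TopologicalSpace.Opens Spacetime), ℝ)),
    Pi z (polyVec k) ψ = ∫ y, monomial (y - z) k * ψ y

/-! ### Weighted spaces of modelled distributions -/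

/-- `f` belongs to `𝓓^{γ,η,T}_p`, the space of modelled distributions associated with the model
`M`. -/
structure IsModelled {θ : ℝ} {r : ℕ} (M : Model θ r) (γ η T : ℝ) (p : ℝ≥0∞)
    (f : Spacetime → ModelSpace) : Prop where
  measurable : ∀ σ : symbols, AEMeasurable (fun z => f z σ) (volume.restrict (strip T))
  periodic : IsPeriodic T f
  below : ∀ z ∈ strip T, BelowLevel θ γ (f z)
  local_bound : ∀ ζ ∈ homogeneities θ, ζ < γ →
    eLpNorm (fun z => levelNorm θ ζ (f z) / z 0 ^ ((η - ζ) / 2)) p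
      (volume.restrict (torusSlab 0 T)) < ⊤
  translation_bound : ∀ ζ ∈ homogeneities θ, ζ < γ →
    ⨆ h ∈ {h : Spacetime | scaledNorm h < 1},
      eLpNorm (fun z => levelNorm θ ζ (f (z + h) - (M.Gam (z + h) z).1 (f z)) /
          (scaledNorm h ^ (γ - ζ) * z 0 ^ ((η - γ) / 2))) p
        (volume.restrict (torusSlab (3 * scaledNorm h ^ 2) (T - scaledNorm h ^ 2))) < ⊤

/-! ### Convolution with the heat kernel -/

/-- The heat kernel `P(t, x) = 1_{t > 0} (4πt)^{-3/2} exp(-|x|²/(4t))` on `ℝ × ℝ³`. -/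
def heatKernel (z : Spacetime) : ℝ :=
  if 0 < z 0 then
    (4 * Real.pi * z 0) ^ (-(3 / 2) : ℝ) * Real.exp (-(∑ i : Fin 3, z i.succ ^ 2) / (4 * z 0))
  else 0

/-- The multi-indices with `|k| < 2`. -/
def smallIndices : Finset MultiIndex :=
  (Fintype.piFinset fun _ => Finset.range 2).filter fun k => k.deg < 2

/-- `⟨h, ∂^k P(z - ·)⟩` for `h` on `(0, T) × 𝕋³`, viewed as a periodic function on `(0, T) × ℝ³`. -/
def heatPairing (T : ℝ) (h : Spacetime → ℝ) (k : MultiIndex) (z : Spacetime) : ℝ :=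
  ∫ w in strip T, h w * iterPartialD k heatKernel (z - w)

/-- `𝓟h(z) = ∑_{|k| < 2} X^k / k! ⟨h, ∂^k P(z - ·)⟩`. -/
def heatLift (T : ℝ) (h : Spacetime → ℝ) (z : Spacetime) : ModelSpace :=
  ∑ k ∈ smallIndices, (heatPairing T h k z / k.fact) • polyVec k

end ConvShift

end

noncomputable section

namespace ConvShift

/-! ### Polynomial components of the model space -/

-- Put F = P * h. Time has degree two, so the lift is the affine polynomial F(z) 1 + ∑ᵢ ∂ᵢF(z) Xᵢ in
-- the space variables (`heatLift_eq`). Every model must act on such polynomials by the true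
-- translation (`Gam_polyVec_spaceIndex`), hence the quantities to control are F, ∇F, the
-- first-order Taylor remainder of F and the increment of ∇F.
--
-- The heart is a pointwise estimate of the kernel. Let ρ be the parabolic size of a shift a, v =
-- (t, x) and σ = √t. A space derivative of P costs a factor 1/σ and a time derivative 1/σ². If 2ρ ≤
-- σ, the mean value theorem bounds the Taylor remainder of P by (ρ/σ)² times a wider Gaussian; if
-- not, each term of the remainder is small by itself. In both cases it is at most a constant times
-- ρ^(2-κ) (M(v) + M(v + a)), where M = `majorant κ` is σ^(κ-2) times the Gaussian
-- (`abs_heatKernel_taylor_increment_le`). The increment of ∇P obeys the same bound with ρ^(1-κ)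
-- (`abs_heatDeriv_increment_le`). Integrating M in space leaves a multiple of t^(κ/2-1), which is
-- integrable at 0 precisely because κ > 0.
--
-- After division by the weights, everything is therefore bounded by N(z) + N(z + a), where N =
-- `maximal` is the convolution of |h| with M. Young's inequality for periodic functions
-- (`lintegral_conv_sq_le`) puts N in L² of the unit cell, and a translation does not change its
-- norm there, so the bound is uniform in a. The local bounds follow in the same way from |P| ≤ C
-- t^(1-κ/2) M and |∂ᵢP| ≤ C t^((1-κ)/2) M.
--
-- For 1 ≤ κ < 2 the projection removes the gradient, and the plain increment of F suffices since 2
-- - κ ≤ 1. For κ ≥ 2 the projection is zero.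

lemma Symb.hom_mul (θ : ℝ) (a b : Symb) : (a * b).hom θ = a.hom θ + b.hom θ := by
  obtain ⟨a, rfl⟩ := Quotient.exists_rep a
  obtain ⟨b, rfl⟩ := Quotient.exists_rep b
  rfl

lemma Symb.hom_one (θ : ℝ) : (1 : Symb).hom θ = 0 := rfl

lemma Symb.hom_pow (θ : ℝ) (a : Symb) (n : ℕ) : (a ^ n).hom θ = n * a.hom θ := by
  induction n with
  | zero => simp [Symb.hom_one]
  | succ n ih => rw [pow_succ, Symb.hom_mul, ih]; push_cast; ring

lemma Symb.hom_Xpow (θ : ℝ) (k : MultiIndex) : (Symb.Xpow k).hom θ = k.deg := by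
  have hX : ∀ i, (Symb.X i).hom θ = scaling i := fun _ => rfl
  simp only [Symb.Xpow, MultiIndex.deg, Fin.prod_univ_four, Fin.sum_univ_four, Symb.hom_mul,
    Symb.hom_pow, hX]
  push_cast
  ring

lemma incl_single (σ : symbols) (c : ℝ) : incl (Finsupp.single σ c) = c • gen σ.1 := by
  simp [incl]

lemma incl_polyVec (k : MultiIndex) : incl (polyVec k) = gen (.Xpow k) := by
  simp [polyVec, incl_single, polySymbol]

/-- The structure group is described by automorphisms of the ambient algebra; injectivity carries
identities proved there back to the model space. -/
lemma incl_injective : Function.Injective incl := by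
  have h : LinearIndependent ℝ (fun σ : symbols => gen σ.1) := by
    have h1 : LinearIndependent ℝ (fun τ : Symb => gen τ) :=
      .of_comp (MonoidAlgebra.coeffLinearEquiv ℝ).toLinearMap
        (Finsupp.linearIndependent_single_one ℝ Symb)
    exact h1.comp _ Subtype.val_injective
  exact h

lemma levelNorm_eq_sum (θ ζ : ℝ) (τ : ModelSpace) (s : Finset symbols) (hs : τ.support ⊆ s) :
    levelNorm θ ζ τ = ∑ σ ∈ s with σ.1.hom θ = ζ, |τ σ| := by
  refine Finset.sum_subset (Finset.filter_subset_filter _ hs) fun σ hσ hσ' => ?_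
  simp only [Finset.mem_filter, Finsupp.mem_support_iff] at hσ hσ'
  have : τ σ = 0 := by by_contra h; exact hσ' ⟨h, hσ.2⟩
  simp [this]

lemma levelNorm_nonneg (θ ζ : ℝ) (τ : ModelSpace) : 0 ≤ levelNorm θ ζ τ :=
  Finset.sum_nonneg fun _ _ => abs_nonneg _

lemma levelNorm_zero (θ ζ : ℝ) : levelNorm θ ζ 0 = 0 := by simp [levelNorm]

lemma levelNorm_add_le (θ ζ : ℝ) (τ τ' : ModelSpace) :
    levelNorm θ ζ (τ + τ') ≤ levelNorm θ ζ τ + levelNorm θ ζ τ' := by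
  classical
  rw [levelNorm_eq_sum θ ζ (τ + τ') _ Finsupp.support_add,
    levelNorm_eq_sum θ ζ τ (τ.support ∪ τ'.support) Finset.subset_union_left,
    levelNorm_eq_sum θ ζ τ' (τ.support ∪ τ'.support) Finset.subset_union_right,
    ← Finset.sum_add_distrib]
  exact Finset.sum_le_sum fun σ _ => abs_add_le _ _

lemma levelNorm_sum_le {ι : Type*} (θ ζ : ℝ) (s : Finset ι) (τ : ι → ModelSpace) :
    levelNorm θ ζ (∑ i ∈ s, τ i) ≤ ∑ i ∈ s, levelNorm θ ζ (τ i) := by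
  classical
  induction s using Finset.induction_on with
  | empty => simp [levelNorm_zero]
  | insert i s hi ih =>
    rw [Finset.sum_insert hi, Finset.sum_insert hi]
    exact (levelNorm_add_le ..).trans (by gcongr)

lemma levelNorm_smul_polyVec (θ ζ c : ℝ) (k : MultiIndex) :
    levelNorm θ ζ (c • polyVec k) = if (k.deg : ℝ) = ζ then |c| else 0 := by
  have h : c • polyVec k = Finsupp.single (polySymbol k) c := by simp [polyVec]
  rw [h, levelNorm_eq_sum θ ζ _ {polySymbol k} Finsupp.support_single_subset,
    Finset.sum_filter, Finset.sum_singleton]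
  simp [polySymbol, Symb.hom_Xpow]

/-- The multi-index of the coordinate `xᵢ`. -/
def spaceIndex (i : Fin 3) : MultiIndex := Pi.single i.succ 1

lemma deg_zero : MultiIndex.deg 0 = 0 := by simp [MultiIndex.deg]

lemma scaling_succ (i : Fin 3) : scaling i.succ = 1 := by fin_cases i <;> rfl

lemma deg_spaceIndex (i : Fin 3) : (spaceIndex i).deg = 1 := by
  fin_cases i <;> rfl

lemma fact_zero : MultiIndex.fact 0 = 1 := rfl

lemma fact_spaceIndex (i : Fin 3) : (spaceIndex i).fact = 1 := by
  fin_cases i <;> rfl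

lemma spaceIndex_injective : Function.Injective spaceIndex := by
  intro i j h
  by_contra hij
  have := congrFun h i.succ
  simp [spaceIndex, hij] at this

lemma smallIndices_eq :
    smallIndices = insert 0 (Finset.univ.image spaceIndex) := by
  ext k
  simp only [smallIndices, Finset.mem_filter, Fintype.mem_piFinset, Finset.mem_range,
    Finset.mem_insert, Finset.mem_image, Finset.mem_univ, true_and]
  constructor
  · rintro ⟨-, hk⟩
    simp only [MultiIndex.deg, Fin.sum_univ_four, scaling] at hk
    simp at hk
    rcases (by omega : (k 1 = 0 ∧ k 2 = 0 ∧ k 3 = 0) ∨ (k 1 = 1 ∧ k 2 = 0 ∧ k 3 = 0) ∨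
      (k 1 = 0 ∧ k 2 = 1 ∧ k 3 = 0) ∨ (k 1 = 0 ∧ k 2 = 0 ∧ k 3 = 1)) with h | h | h | h
    · left; funext i; fin_cases i <;> simp <;> omega
    · right; refine ⟨0, funext fun i => ?_⟩
      fin_cases i <;> simp [spaceIndex] <;> omega
    · right; refine ⟨1, funext fun i => ?_⟩
      fin_cases i <;> simp [spaceIndex] <;> omega
    · right; refine ⟨2, funext fun i => ?_⟩
      fin_cases i <;> simp [spaceIndex] <;> omega
  · rintro (rfl | ⟨i, rfl⟩)
    · simp [deg_zero]
    · refine ⟨fun j => ?_, by simp [deg_spaceIndex]⟩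
      by_cases h : j = i.succ <;> simp [spaceIndex, h]

lemma sum_smallIndices {E : Type*} [AddCommMonoid E] (F : MultiIndex → E) :
    ∑ k ∈ smallIndices, F k = F 0 + ∑ i, F (spaceIndex i) := by
  rw [smallIndices_eq, Finset.sum_insert, Finset.sum_image spaceIndex_injective.injOn]
  simp only [Finset.mem_image, Finset.mem_univ, true_and, not_exists]
  intro i h
  simpa [spaceIndex] using congrFun h i.succ

lemma monomial_spaceIndex (z : Spacetime) (i : Fin 3) : monomial z (spaceIndex i) = z i.succ := by
  simp [monomial, spaceIndex, Pi.single_apply, pow_ite]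

lemma monomial_zero (z : Spacetime) : monomial z 0 = 1 := by simp [monomial]

lemma gen_Xpow_zero : gen (.Xpow 0) = 1 := by simp [gen_Xpow]

lemma gen_Xpow_spaceIndex (i : Fin 3) : gen (.Xpow (spaceIndex i)) = gen (.X i.succ) := by
  simp [gen_Xpow, spaceIndex, Pi.single_apply, pow_ite]

/-! ### The action of the structure group on polynomials -/

lemma exists_testFunction_integral_ne_zero :
    ∃ ψ : 𝓓((⊤ : TopologicalSpace.Opens Spacetime), ℝ), ∫ y, ψ y ≠ 0 := by
  let b : ContDiffBump (0 : Spacetime) := ⟨1, 2, one_pos, one_lt_two⟩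
  refine ⟨⟨b, b.contDiff, b.hasCompactSupport, by simp⟩, ?_⟩
  exact b.integral_pos.ne'

lemma Gam_polyVec_zero {θ : ℝ} {r : ℕ} (M : Model θ r) (z z' : Spacetime) :
    (M.Gam z z').1 (polyVec 0) = polyVec 0 := by
  obtain ⟨Φ, -, hΦ⟩ := (M.Gam z z').2
  apply incl_injective
  rw [hΦ, incl_polyVec, gen_Xpow_zero, map_one]

/-- Membership in the structure group only gives a translation by some unknown vector c. The
relation Π_z Γ_{z,z'} = Π_{z'}, together with the canonical action of Π on polynomials, determines
c: pairing with a test function of nonzero integral forces cᵢ = zᵢ - z'ᵢ. -/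
lemma Gam_polyVec_spaceIndex {θ : ℝ} {r : ℕ} (M : Model θ r) (z z' : Spacetime) (i : Fin 3) :
    (M.Gam z z').1 (polyVec (spaceIndex i)) =
      polyVec (spaceIndex i) + (z i.succ - z' i.succ) • polyVec 0 := by
  obtain ⟨Φ, ⟨⟨c, hc⟩, -⟩, hΦ⟩ := (M.Gam z z').2
  have h1 : (M.Gam z z').1 (polyVec (spaceIndex i)) =
      polyVec (spaceIndex i) + c i.succ • polyVec 0 := by
    apply incl_injective
    rw [hΦ, map_add, map_smul, incl_polyVec, incl_polyVec, gen_Xpow_zero, gen_Xpow_spaceIndex, hc,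
      Algebra.algebraMap_eq_smul_one]
  obtain ⟨ψ, hψ⟩ := exists_testFunction_integral_ne_zero
  have hint : ∀ f : Spacetime → ℝ, Continuous f → Integrable fun y => f y * ψ y := fun f hf =>
    (hf.mul ψ.continuous).integrable_of_hasCompactSupport ψ.hasCompactSupport.mul_left
  have h2 := congrArg (fun d => d ψ) (M.Pi_Gam z z' (polyVec (spaceIndex i)))
  simp only [h1, map_add, map_smul] at h2
  have h3 : ∀ (S S' : 𝓓'((⊤ : TopologicalSpace.Opens Spacetime), ℝ)) (a : ℝ),
      (S + a • S') ψ = S ψ + a * S' ψ := fun _ _ _ => rfl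
  rw [h3, M.Pi_poly, M.Pi_poly, M.Pi_poly] at h2
  simp only [monomial_spaceIndex, monomial_zero, Pi.sub_apply, one_mul] at h2
  have h4 : ∫ y, (y i.succ - z' i.succ) * ψ y =
      (∫ y, (y i.succ - z i.succ) * ψ y) + (z i.succ - z' i.succ) * ∫ y, ψ y := by
    rw [← integral_const_mul, ← integral_add (hint _ (by fun_prop)) (hint _ (by fun_prop))]
    congr 1 with y
    ring
  have h4 : (c i.succ - (z i.succ - z' i.succ)) * ∫ y, ψ y = 0 := by linarith
  rcases mul_eq_zero.1 h4 with h5 | h5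
  · rw [h1, sub_eq_zero.1 h5]
  · exact absurd h5 hψ

/-! ### Derivatives of the heat kernel -/

/-- `|x|²` for the space-time point `(t, x)`. -/
def spaceSq (v : Spacetime) : ℝ := ∑ i : Fin 3, v i.succ ^ 2

lemma spaceSq_nonneg (v : Spacetime) : 0 ≤ spaceSq v := Finset.sum_nonneg fun _ _ => sq_nonneg _

lemma sq_le_spaceSq (v : Spacetime) (i : Fin 3) : v i.succ ^ 2 ≤ spaceSq v :=
  Finset.single_le_sum (f := fun i : Fin 3 => v i.succ ^ 2) (fun _ _ => sq_nonneg _)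
    (Finset.mem_univ i)

lemma heatKernel_of_pos {v : Spacetime} (hv : 0 < v 0) :
    heatKernel v = (4 * Real.pi * v 0) ^ (-(3 / 2) : ℝ) * Real.exp (-spaceSq v / (4 * v 0)) := by
  simp [heatKernel, hv, spaceSq]

lemma heatKernel_of_nonpos {v : Spacetime} (hv : v 0 ≤ 0) : heatKernel v = 0 := by
  simp [heatKernel, not_lt.2 hv]

lemma heatKernel_nonneg (v : Spacetime) : 0 ≤ heatKernel v := by
  rcases lt_or_ge 0 (v 0) with hv | hv
  · rw [heatKernel_of_pos hv]; positivity
  · rw [heatKernel_of_nonpos hv]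

/-- The spatial derivative `∂ᵢP`. -/
def heatDeriv (i : Fin 3) (v : Spacetime) : ℝ := -(v i.succ / (2 * v 0)) * heatKernel v

lemma heatDeriv_of_nonpos {v : Spacetime} (hv : v 0 ≤ 0) (i : Fin 3) : heatDeriv i v = 0 := by
  simp [heatDeriv, heatKernel_of_nonpos hv]

/-- The contribution of the time direction to the logarithmic derivative of `P` along `a`. -/
def logDerivTime (w a : Spacetime) : ℝ := a 0 / w 0 * (-(3 / 2) + spaceSq w / (4 * w 0))

/-- The logarithmic derivative of `P` along `a`. -/
def logDerivHeat (w a : Spacetime) : ℝ :=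
  logDerivTime w a - (∑ i : Fin 3, w i.succ * a i.succ) / (2 * w 0)

lemma hasDerivAt_heatKernel_line (v a : Spacetime) (s : ℝ) (hs : 0 < (v + s • a) 0) :
    HasDerivAt (fun s : ℝ => heatKernel (v + s • a))
      (heatKernel (v + s • a) * logDerivHeat (v + s • a) a) s := by
  have hc : ∀ j, HasDerivAt (fun s : ℝ => (v + s • a) j) (a j) s := fun j => by
    simpa using ((hasDerivAt_id s).mul_const (a j)).const_add (v j)
  have hS : HasDerivAt (fun s : ℝ => spaceSq (v + s • a))
      (∑ i : Fin 3, 2 * (v + s • a) i.succ * a i.succ) s := by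
    have := HasDerivAt.fun_sum (u := Finset.univ) fun (i : Fin 3) _ => (hc i.succ).pow 2
    simpa [spaceSq] using this
  have h1 : HasDerivAt (fun s : ℝ => (4 * Real.pi * (v + s • a) 0) ^ (-(3 / 2) : ℝ) *
      Real.exp (-spaceSq (v + s • a) / (4 * (v + s • a) 0)))
      (heatKernel (v + s • a) * logDerivHeat (v + s • a) a) s := by
    have hpos : 0 < 4 * Real.pi * (v + s • a) 0 := by positivity
    have h2 := ((hc 0).const_mul (4 * Real.pi)).rpow_const (p := (-(3 / 2) : ℝ)) (Or.inl hpos.ne')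
    have h3 := (hS.neg.div ((hc 0).const_mul 4) (by positivity)).exp
    refine (h2.mul h3).congr_deriv ?_
    rw [heatKernel_of_pos hs, Real.rpow_sub_one hpos.ne', logDerivHeat, logDerivTime]
    simp only [Pi.neg_apply, Pi.div_apply, ← Finset.mul_sum, mul_assoc]
    field_simp
    ring
  refine h1.congr_of_eventuallyEq ?_
  filter_upwards [(hc 0).continuousAt.eventually_const_lt hs] with s' hs'
  exact heatKernel_of_pos hs'

lemma hasDerivAt_heatDeriv_line (i : Fin 3) (v a : Spacetime) (s : ℝ) (hs : 0 < (v + s • a) 0) :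
    HasDerivAt (fun s : ℝ => heatDeriv i (v + s • a))
      (heatKernel (v + s • a) * (-(a i.succ / (2 * (v + s • a) 0)) +
        (v + s • a) i.succ / (2 * (v + s • a) 0) * (a 0 / (v + s • a) 0) -
        (v + s • a) i.succ / (2 * (v + s • a) 0) * logDerivHeat (v + s • a) a)) s := by
  have hc : ∀ j, HasDerivAt (fun s : ℝ => (v + s • a) j) (a j) s := fun j => by
    simpa using ((hasDerivAt_id s).mul_const (a j)).const_add (v j)
  refine (((hc i.succ).div ((hc 0).const_mul 2) (by positivity)).neg.mul
    (hasDerivAt_heatKernel_line v a s hs)).congr_deriv ?_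
  simp only [Pi.neg_apply, Pi.div_apply]
  field_simp
  ring

lemma iterPartialD_spaceIndex (i : Fin 3) (f : Spacetime → ℝ) :
    iterPartialD (spaceIndex i) f = partialD i.succ f := by
  fin_cases i <;> rfl

lemma partialD_heatKernel (i : Fin 3) : partialD i.succ heatKernel = heatDeriv i := by
  ext v
  rw [partialD, lineDeriv]
  rcases lt_or_ge 0 (v 0) with hv | hv
  · have h := hasDerivAt_heatKernel_line v (Pi.single i.succ 1) 0 (by simpa using hv)
    rw [h.deriv]
    simp [logDerivHeat, logDerivTime, heatDeriv, Pi.single_apply]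
    ring
  · rw [heatDeriv_of_nonpos hv]
    -- A line in a space direction stays inside {t ≤ 0}, where P vanishes, so the singularity of P
    -- at the origin is harmless, also at time zero.
    have : (fun t : ℝ => heatKernel (v + t • Pi.single i.succ 1)) = fun _ => 0 := by
      ext t
      exact heatKernel_of_nonpos (by simpa using hv)
    rw [this, deriv_const]

/-! ### Gaussian bounds -/

/-- A Gaussian that dominates the heat kernel and its derivatives. -/
def gaussian (v : Spacetime) : ℝ := v 0 ^ (-(3 / 2) : ℝ) * Real.exp (-spaceSq v / (20 * v 0))

/-- The size of space-time shifts of parabolic size at most `ρ`. -/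
def SmallShift (ρ : ℝ) (a : Spacetime) : Prop := |a 0| ≤ ρ ^ 2 ∧ ∀ i : Fin 3, |a i.succ| ≤ ρ

lemma SmallShift.smul {ρ : ℝ} {a : Spacetime} (h : SmallShift ρ a) {s : ℝ} (hs : s ∈ Icc (0 : ℝ) 1) :
    SmallShift ρ (s • a) := by
  have key : ∀ x b : ℝ, |x| ≤ b → |s * x| ≤ b := fun x b hx => by
    rw [abs_mul, abs_of_nonneg hs.1]
    exact (mul_le_of_le_one_left (abs_nonneg _) hs.2).trans hx
  exact ⟨key _ _ h.1, fun i => key _ _ (h.2 i)⟩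

/-- The constant in `heatKernel_mul_le_gaussian`. -/
def gaussianConst : ℝ := (3 / 4 : ℝ) ^ (-(3 / 2) : ℝ) * (128 * Real.exp 1)

lemma gaussianConst_pos : 0 < gaussianConst := by unfold gaussianConst; positivity

lemma time_add_mem {ρ : ℝ} {v a : Spacetime} (ha : SmallShift ρ a)
    (hρ : 4 * ρ ^ 2 ≤ v 0) : (v + a) 0 ∈ Icc (3 / 4 * v 0) (5 / 4 * v 0) := by
  have := abs_le.1 ha.1
  simp only [Pi.add_apply, mem_Icc]
  constructor <;> linarith

/-- In each coordinate (x + a)² - x²/2 + a² = (x + 2a)²/2 ≥ 0. -/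
lemma spaceSq_add_ge {ρ : ℝ} {v a : Spacetime} (ha : SmallShift ρ a) :
    spaceSq v / 2 - 3 * ρ ^ 2 ≤ spaceSq (v + a) := by
  have h : ∀ i : Fin 3, v i.succ ^ 2 / 2 - ρ ^ 2 ≤ (v + a) i.succ ^ 2 := fun i => by
    have h1 : a i.succ ^ 2 ≤ ρ ^ 2 := sq_le_sq' (abs_le.1 (ha.2 i)).1 (abs_le.1 (ha.2 i)).2
    simp only [Pi.add_apply]
    nlinarith [sq_nonneg (v i.succ + 2 * a i.succ)]
  have := Finset.sum_le_sum fun (i : Fin 3) (_ : i ∈ Finset.univ) => h i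
  rw [Finset.sum_sub_distrib, ← Finset.sum_div] at this
  simpa [spaceSq] using this

/-- Half of the Gaussian decay pays for the polynomial factor, and the other half survives the
shift: with w = v + a the exponent -|w|²/(8 w₀) is at most -|w|²/(10 v₀), because w₀ ≤ 5 v₀/4, and
then `spaceSq_add_ge` gives -|v|²/(20 v₀) up to an error at most 1, which is the factor e in
`gaussianConst`. The power of 3/4 comes from w₀ ≥ 3 v₀/4. -/
lemma heatKernel_mul_le_gaussian {ρ : ℝ} {v a : Spacetime} (ha : SmallShift ρ a) (hv : 0 < v 0)
    (hρ : 4 * ρ ^ 2 ≤ v 0) :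
    heatKernel (v + a) * (1 + spaceSq (v + a) / (v + a) 0) ^ 2 ≤ gaussianConst * gaussian v := by
  obtain ⟨h1, h2⟩ := time_add_mem ha hρ
  have hS := spaceSq_add_ge (v := v) ha
  set w := v + a
  have hw : 0 < w 0 := by linarith
  have hS0 := spaceSq_nonneg w
  set q := spaceSq w / w 0 with hq
  have hq0 : 0 ≤ q := by positivity
  have e1 : (4 * Real.pi * w 0) ^ (-(3 / 2) : ℝ) ≤
      (3 / 4 : ℝ) ^ (-(3 / 2) : ℝ) * v 0 ^ (-(3 / 2) : ℝ) := by
    rw [← Real.mul_rpow (by norm_num) hv.le]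
    refine Real.rpow_le_rpow_of_nonpos (by positivity) (h1.trans ?_) (by norm_num)
    nlinarith [Real.pi_gt_three]
  -- The constant 128 makes the quadratic term of 128 exp(q/8) equal to q².
  have e2 : (1 + q) ^ 2 ≤ 128 * Real.exp (q / 8) := by
    have := Real.quadratic_le_exp_of_nonneg (show 0 ≤ q / 8 by positivity)
    nlinarith
  have e3 : -spaceSq w / (4 * w 0) + q / 8 ≤ 1 + -spaceSq v / (20 * v 0) := by
    have e4 : -spaceSq w / (4 * w 0) + q / 8 = -(spaceSq w / (8 * w 0)) := by
      rw [hq]; field_simp; ring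
    have e5 : spaceSq w / (10 * v 0) ≤ spaceSq w / (8 * w 0) := by
      exact div_le_div_of_nonneg_left hS0 (by positivity) (by linarith)
    have e6 : (spaceSq v / 2 - 3 * ρ ^ 2) / (10 * v 0) ≤ spaceSq w / (10 * v 0) := by gcongr
    have e7 : (spaceSq v / 2 - 3 * ρ ^ 2) / (10 * v 0) =
        spaceSq v / (20 * v 0) - 3 * ρ ^ 2 / (10 * v 0) := by field_simp; ring
    have e8 : 3 * ρ ^ 2 / (10 * v 0) ≤ 1 := by
      rw [div_le_one (by positivity)]; nlinarith [sq_nonneg ρ]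
    rw [e4, neg_div]; linarith
  rw [heatKernel_of_pos hw]
  calc (4 * Real.pi * w 0) ^ (-(3 / 2) : ℝ) * Real.exp (-spaceSq w / (4 * w 0)) * (1 + q) ^ 2
      ≤ ((3 / 4 : ℝ) ^ (-(3 / 2) : ℝ) * v 0 ^ (-(3 / 2) : ℝ)) * Real.exp (-spaceSq w / (4 * w 0)) *
        (128 * Real.exp (q / 8)) := by gcongr
    _ = ((3 / 4 : ℝ) ^ (-(3 / 2) : ℝ) * v 0 ^ (-(3 / 2) : ℝ)) * 128 *
        Real.exp (-spaceSq w / (4 * w 0) + q / 8) := by rw [Real.exp_add]; ring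
    _ ≤ ((3 / 4 : ℝ) ^ (-(3 / 2) : ℝ) * v 0 ^ (-(3 / 2) : ℝ)) * 128 *
        Real.exp (1 + -spaceSq v / (20 * v 0)) := by gcongr
    _ = gaussianConst * gaussian v := by
      rw [Real.exp_add, gaussianConst, gaussian]; ring

lemma heatKernel_mul_self_le_gaussian {v : Spacetime} (hv : 0 < v 0) :
    heatKernel v * (1 + spaceSq v / v 0) ^ 2 ≤ gaussianConst * gaussian v := by
  simpa using heatKernel_mul_le_gaussian (ρ := 0) (v := v) (a := 0)
    ⟨by simp, fun i => by simp⟩ hv (by simpa using hv.le)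

-- Logarithmic derivatives of the kernel at times at least 3σ²/4

section LineBounds

variable {ρ : ℝ} {σ : ℝ} {w a : Spacetime}

/-- This is |x|σ ≤ (|x|² + σ²)/2 with σ² ≤ 4 w₀/3. It turns a factor |x|/t into 1/σ times a
polynomial that the Gaussian absorbs. -/
lemma abs_space_div_time_le (hσ : 0 < σ) (hw : 3 / 4 * σ ^ 2 ≤ w 0) (i : Fin 3) :
    |w i.succ| / w 0 ≤ (1 + spaceSq w / w 0) / σ := by
  have hw0 : 0 < w 0 := lt_of_lt_of_le (by positivity) hw
  have h1 := sq_le_spaceSq w i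
  rw [div_le_div_iff₀ hw0 hσ, add_mul, one_mul, div_mul_cancel₀ _ hw0.ne']
  nlinarith [sq_nonneg (|w i.succ| - σ), sq_abs (w i.succ), spaceSq_nonneg w]

lemma abs_time_div_time_le (hσ : 0 < σ) (hw : 3 / 4 * σ ^ 2 ≤ w 0) (ha : SmallShift ρ a) :
    |a 0 / w 0| ≤ 4 / 3 * (ρ / σ) ^ 2 := by
  have hw0 : 0 < w 0 := lt_of_lt_of_le (by positivity) hw
  rw [abs_div, abs_of_pos hw0, div_pow, div_le_iff₀ hw0]
  calc |a 0| ≤ ρ ^ 2 := ha.1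
    _ = 4 / 3 * (ρ ^ 2 / σ ^ 2) * (3 / 4 * σ ^ 2) := by field_simp
    _ ≤ _ := by gcongr

/-- The gain is quadratic in ρ/σ, since |a₀| ≤ ρ². This is why the Taylor polynomial of degree one
needs no time derivative. -/
lemma abs_logDerivTime_le (hσ : 0 < σ) (hw : 3 / 4 * σ ^ 2 ≤ w 0) (ha : SmallShift ρ a) :
    |logDerivTime w a| ≤ 2 * (ρ / σ) ^ 2 * (1 + spaceSq w / w 0) := by
  have hw0 : 0 < w 0 := lt_of_lt_of_le (by positivity) hw
  have hq : 0 ≤ spaceSq w / w 0 := div_nonneg (spaceSq_nonneg w) hw0.le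
  have h1 : |-(3 / 2) + spaceSq w / (4 * w 0)| ≤ 3 / 2 * (1 + spaceSq w / w 0) := by
    rw [show spaceSq w / (4 * w 0) = spaceSq w / w 0 / 4 by field_simp, abs_le]
    constructor <;> linarith
  rw [logDerivTime, abs_mul]
  calc _ ≤ 4 / 3 * (ρ / σ) ^ 2 * (3 / 2 * (1 + spaceSq w / w 0)) :=
        mul_le_mul (abs_time_div_time_le hσ hw ha) h1 (abs_nonneg _) (by positivity)
    _ = _ := by ring

lemma abs_logDerivHeat_le (hρ : 0 ≤ ρ) (hσ : 0 < σ) (hρσ : 2 * ρ ≤ σ) (hw : 3 / 4 * σ ^ 2 ≤ w 0)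
    (ha : SmallShift ρ a) : |logDerivHeat w a| ≤ 3 * (ρ / σ) * (1 + spaceSq w / w 0) := by
  have hw0 : 0 < w 0 := lt_of_lt_of_le (by positivity) hw
  have hq : 0 ≤ spaceSq w / w 0 := div_nonneg (spaceSq_nonneg w) hw0.le
  have h1 := abs_logDerivTime_le hσ hw ha
  have h2 : ∀ i : Fin 3, |w i.succ * a i.succ / (2 * w 0)| ≤
      1 / 2 * (ρ / σ) * (1 + spaceSq w / w 0) := fun i => by
    rw [show w i.succ * a i.succ / (2 * w 0) = 1 / 2 * (w i.succ / w 0 * a i.succ) by field_simp,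
      abs_mul, abs_mul, abs_div (w i.succ), abs_of_pos hw0,
      abs_of_pos (show (0 : ℝ) < 1 / 2 by norm_num)]
    calc _ ≤ 1 / 2 * ((1 + spaceSq w / w 0) / σ * ρ) := by
          exact mul_le_mul_of_nonneg_left (mul_le_mul (abs_space_div_time_le hσ hw i) (ha.2 i)
            (abs_nonneg _) (by positivity)) (by norm_num)
      _ = _ := by ring
  have h3 : |(∑ i : Fin 3, w i.succ * a i.succ) / (2 * w 0)| ≤
      3 * (1 / 2 * (ρ / σ) * (1 + spaceSq w / w 0)) := by
    rw [Finset.sum_div]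
    refine (Finset.abs_sum_le_sum_abs _ _).trans ?_
    simpa using Finset.sum_le_sum fun (i : Fin 3) (_ : i ∈ Finset.univ) => h2 i
  -- Since ρ/σ ≤ 1/2, the quadratic time contribution is absorbed into a linear one; the total
  -- coefficient is 1 + 3/2 ≤ 3.
  have h4 : ρ / σ ≤ 1 / 2 := by rw [div_le_iff₀ hσ]; linarith
  have h5 : 0 ≤ ρ / σ := by positivity
  have h6 : (ρ / σ) ^ 2 ≤ 1 / 2 * (ρ / σ) := by nlinarith
  have h7 := mul_le_mul_of_nonneg_right h6 (show 0 ≤ 1 + spaceSq w / w 0 by linarith)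
  have h8 := mul_nonneg h5 (show 0 ≤ 1 + spaceSq w / w 0 by linarith)
  rw [logDerivHeat]
  refine (abs_sub _ _).trans ?_
  linarith

lemma abs_deriv_heatDeriv_le (hρ : 0 ≤ ρ) (hσ : 0 < σ) (hρσ : 2 * ρ ≤ σ)
    (hw : 3 / 4 * σ ^ 2 ≤ w 0) (ha : SmallShift ρ a) (i : Fin 3) :
    |-(a i.succ / (2 * w 0)) + w i.succ / (2 * w 0) * (a 0 / w 0) -
      w i.succ / (2 * w 0) * logDerivHeat w a| ≤
      3 * (ρ / σ ^ 2) * (1 + spaceSq w / w 0) ^ 2 := by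
  have hw0 : 0 < w 0 := lt_of_lt_of_le (by positivity) hw
  have hq : 0 ≤ spaceSq w / w 0 := div_nonneg (spaceSq_nonneg w) hw0.le
  set Q := 1 + spaceSq w / w 0
  have hQ : 1 ≤ Q := by simp only [Q]; linarith
  have hx : |w i.succ / (2 * w 0)| ≤ 1 / 2 * (Q / σ) := by
    rw [show w i.succ / (2 * w 0) = 1 / 2 * (w i.succ / w 0) by field_simp,
      abs_mul, abs_div (w i.succ), abs_of_pos hw0,
      abs_of_pos (show (0 : ℝ) < 1 / 2 by norm_num)]
    exact mul_le_mul_of_nonneg_left (abs_space_div_time_le hσ hw i) (by norm_num)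
  have h1 : |-(a i.succ / (2 * w 0))| ≤ 2 / 3 * (ρ / σ ^ 2) := by
    rw [abs_neg, abs_div, abs_of_pos (show 0 < 2 * w 0 by positivity),
      div_le_iff₀ (by positivity)]
    calc |a i.succ| ≤ ρ := ha.2 i
      _ = 2 / 3 * (ρ / σ ^ 2) * (2 * (3 / 4 * σ ^ 2)) := by field_simp; norm_num
      _ ≤ _ := by gcongr
  have h2 : |w i.succ / (2 * w 0) * (a 0 / w 0)| ≤ 1 / 3 * (ρ / σ ^ 2) * Q := by
    rw [abs_mul]
    calc _ ≤ 1 / 2 * (Q / σ) * (4 / 3 * (ρ / σ) ^ 2) :=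
          mul_le_mul hx (abs_time_div_time_le hσ hw ha) (abs_nonneg _) (by positivity)
      _ = (2 * ρ / σ) * (1 / 3 * (ρ / σ ^ 2) * Q) := by field_simp; norm_num
      _ ≤ 1 * (1 / 3 * (ρ / σ ^ 2) * Q) := by
          gcongr
          rwa [div_le_one hσ]
      _ = _ := one_mul _
  have h3 : |w i.succ / (2 * w 0) * logDerivHeat w a| ≤ 3 / 2 * (ρ / σ ^ 2) * Q ^ 2 := by
    rw [abs_mul]
    calc _ ≤ 1 / 2 * (Q / σ) * (3 * (ρ / σ) * Q) :=
          mul_le_mul hx (abs_logDerivHeat_le hρ hσ hρσ hw ha) (abs_nonneg _) (by positivity)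
      _ = _ := by field_simp
  have h4 : 0 ≤ ρ / σ ^ 2 := by positivity
  have h5 : (ρ / σ ^ 2) ≤ (ρ / σ ^ 2) * Q ^ 2 := le_mul_of_one_le_right h4 (by nlinarith)
  have h6 : (ρ / σ ^ 2) * Q ≤ (ρ / σ ^ 2) * Q ^ 2 := by gcongr; nlinarith
  refine (abs_sub _ _).trans ((add_le_add_left (abs_add_le _ _) _).trans ?_)
  linarith

end LineBounds

lemma exists_mem_Icc_sub_eq_deriv {f f' : ℝ → ℝ}
    (h : ∀ s ∈ Icc (0 : ℝ) 1, HasDerivAt f (f' s) s) :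
    ∃ s ∈ Icc (0 : ℝ) 1, f 1 - f 0 = f' s := by
  obtain ⟨c, hc, e⟩ := exists_hasDerivAt_eq_slope f f' one_pos
    (fun s hs => (h s hs).continuousAt.continuousWithinAt) fun s hs => h s (Ioo_subset_Icc_self hs)
  exact ⟨c, Ioo_subset_Icc_self hc, by rw [e]; simp⟩

-- Increments of the kernel when the shift is small compared with σ = √t

section FarBounds

variable {ρ σ : ℝ} {v a : Spacetime}

lemma line_mem (ha : SmallShift ρ a) (hσ : 0 < σ) (hρ : 0 ≤ ρ) (hρσ : 2 * ρ ≤ σ)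
    (hv : v 0 = σ ^ 2) {s : ℝ} (hs : s ∈ Icc (0 : ℝ) 1) : 3 / 4 * σ ^ 2 ≤ (v + s • a) 0 := by
  have h := (time_add_mem (v := v) (ha.smul hs) (by rw [hv]; nlinarith)).1
  rwa [hv] at h

lemma heatKernel_line_le (ha : SmallShift ρ a) (hσ : 0 < σ) (hρ : 0 ≤ ρ) (hρσ : 2 * ρ ≤ σ)
    (hv : v 0 = σ ^ 2) {s : ℝ} (hs : s ∈ Icc (0 : ℝ) 1) :
    heatKernel (v + s • a) * (1 + spaceSq (v + s • a) / (v + s • a) 0) ^ 2 ≤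
      gaussianConst * gaussian v :=
  heatKernel_mul_le_gaussian (ha.smul hs) (by rw [hv]; positivity) (by rw [hv]; nlinarith)

lemma heatKernel_line_le' (ha : SmallShift ρ a) (hσ : 0 < σ) (hρ : 0 ≤ ρ) (hρσ : 2 * ρ ≤ σ)
    (hv : v 0 = σ ^ 2) {s : ℝ} (hs : s ∈ Icc (0 : ℝ) 1) :
    heatKernel (v + s • a) * (1 + spaceSq (v + s • a) / (v + s • a) 0) ≤
      gaussianConst * gaussian v := by
  refine le_trans ?_ (heatKernel_line_le ha hσ hρ hρσ hv hs)
  have h1 : 0 < (v + s • a) 0 := lt_of_lt_of_le (by positivity) (line_mem ha hσ hρ hρσ hv hs)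
  have h2 : 0 ≤ spaceSq (v + s • a) / (v + s • a) 0 := div_nonneg (spaceSq_nonneg _) h1.le
  have := heatKernel_nonneg (v + s • a)
  gcongr
  nlinarith

lemma abs_heatKernel_sub_le (ha : SmallShift ρ a) (hσ : 0 < σ) (hρ : 0 ≤ ρ) (hρσ : 2 * ρ ≤ σ)
    (hv : v 0 = σ ^ 2) :
    |heatKernel (v + a) - heatKernel v| ≤ 3 * gaussianConst * ((ρ / σ) * gaussian v) := by
  have hpos : ∀ s ∈ Icc (0 : ℝ) 1, 3 / 4 * σ ^ 2 ≤ (v + s • a) 0 := fun s hs =>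
    line_mem ha hσ hρ hρσ hv hs
  obtain ⟨s, hs, e⟩ := exists_mem_Icc_sub_eq_deriv fun s hs =>
    hasDerivAt_heatKernel_line v a s (lt_of_lt_of_le (by positivity) (hpos s hs))
  simp only [one_smul, zero_smul, add_zero] at e
  rw [e, abs_mul, abs_of_nonneg (heatKernel_nonneg _)]
  calc _ ≤ heatKernel (v + s • a) *
        (3 * (ρ / σ) * (1 + spaceSq (v + s • a) / (v + s • a) 0)) :=
        mul_le_mul_of_nonneg_left (abs_logDerivHeat_le hρ hσ hρσ (hpos s hs) ha)
          (heatKernel_nonneg _)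
    _ = 3 * (ρ / σ) * (heatKernel (v + s • a) *
        (1 + spaceSq (v + s • a) / (v + s • a) 0)) := by ring
    _ ≤ 3 * (ρ / σ) * (gaussianConst * gaussian v) := by
        exact mul_le_mul_of_nonneg_left (heatKernel_line_le' ha hσ hρ hρσ hv hs) (by positivity)
    _ = _ := by ring

lemma abs_heatDeriv_sub_le (ha : SmallShift ρ a) (hσ : 0 < σ) (hρ : 0 ≤ ρ) (hρσ : 2 * ρ ≤ σ)
    (hv : v 0 = σ ^ 2) (i : Fin 3) :
    |heatDeriv i (v + a) - heatDeriv i v| ≤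
      3 * gaussianConst * ((ρ / σ ^ 2) * gaussian v) := by
  have hpos : ∀ s ∈ Icc (0 : ℝ) 1, 3 / 4 * σ ^ 2 ≤ (v + s • a) 0 := fun s hs =>
    line_mem ha hσ hρ hρσ hv hs
  obtain ⟨s, hs, e⟩ := exists_mem_Icc_sub_eq_deriv fun s hs =>
    hasDerivAt_heatDeriv_line i v a s (lt_of_lt_of_le (by positivity) (hpos s hs))
  simp only [one_smul, zero_smul, add_zero] at e
  rw [e, abs_mul, abs_of_nonneg (heatKernel_nonneg _)]
  calc _ ≤ heatKernel (v + s • a) *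
        (3 * (ρ / σ ^ 2) * (1 + spaceSq (v + s • a) / (v + s • a) 0) ^ 2) :=
        mul_le_mul_of_nonneg_left (abs_deriv_heatDeriv_le hρ hσ hρσ (hpos s hs) ha i)
          (heatKernel_nonneg _)
    _ = 3 * (ρ / σ ^ 2) * (heatKernel (v + s • a) *
        (1 + spaceSq (v + s • a) / (v + s • a) 0) ^ 2) := by ring
    _ ≤ 3 * (ρ / σ ^ 2) * (gaussianConst * gaussian v) := by
        exact mul_le_mul_of_nonneg_left (heatKernel_line_le ha hσ hρ hρσ hv hs) (by positivity)
    _ = _ := by ring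

/-- The mean value theorem for s ↦ P(v + sa) - s ∑ᵢ aᵢ ∂ᵢP(v) leaves the time derivative at an
intermediate point, already of order (ρ/σ)², and the products of aᵢ with an increment of ∂ᵢP, of
order ρ · ρ/σ². The constant is 11 = 2 + 3 · 3. -/
lemma abs_heatKernel_taylor_le (ha : SmallShift ρ a) (hσ : 0 < σ) (hρ : 0 ≤ ρ) (hρσ : 2 * ρ ≤ σ)
    (hv : v 0 = σ ^ 2) :
    |heatKernel (v + a) - heatKernel v - ∑ i : Fin 3, a i.succ * heatDeriv i v| ≤
      11 * gaussianConst * ((ρ / σ) ^ 2 * gaussian v) := by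
  have hpos : ∀ s ∈ Icc (0 : ℝ) 1, 3 / 4 * σ ^ 2 ≤ (v + s • a) 0 := fun s hs =>
    line_mem ha hσ hρ hρσ hv hs
  obtain ⟨s, hs, e⟩ := exists_mem_Icc_sub_eq_deriv fun s hs =>
    (hasDerivAt_heatKernel_line v a s (lt_of_lt_of_le (by positivity) (hpos s hs))).sub
      ((hasDerivAt_id s).mul_const (∑ i : Fin 3, a i.succ * heatDeriv i v))
  simp only [Pi.sub_apply, one_smul, zero_smul, add_zero, id, one_mul, zero_mul, sub_zero] at e
  have e' : heatKernel (v + a) - heatKernel v - ∑ i : Fin 3, a i.succ * heatDeriv i v =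
      heatKernel (v + s • a) * logDerivTime (v + s • a) a +
        ∑ i : Fin 3, a i.succ * (heatDeriv i (v + s • a) - heatDeriv i v) := by
    have e1 : ∑ i : Fin 3, a i.succ * heatDeriv i (v + s • a) = -(heatKernel (v + s • a) *
        ((∑ i : Fin 3, (v + s • a) i.succ * a i.succ) / (2 * (v + s • a) 0))) := by
      rw [Finset.sum_div, Finset.mul_sum, ← Finset.sum_neg_distrib]
      refine Finset.sum_congr rfl fun i _ => ?_
      rw [heatDeriv]; ring
    simp only [mul_sub, Finset.sum_sub_distrib, e1]
    rw [logDerivHeat] at e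
    linarith
  have h1 : |heatKernel (v + s • a) * logDerivTime (v + s • a) a| ≤
      2 * (ρ / σ) ^ 2 * (gaussianConst * gaussian v) := by
    rw [abs_mul, abs_of_nonneg (heatKernel_nonneg _)]
    calc _ ≤ heatKernel (v + s • a) *
          (2 * (ρ / σ) ^ 2 * (1 + spaceSq (v + s • a) / (v + s • a) 0)) :=
          mul_le_mul_of_nonneg_left (abs_logDerivTime_le hσ (hpos s hs) ha)
            (heatKernel_nonneg _)
      _ = 2 * (ρ / σ) ^ 2 * (heatKernel (v + s • a) *
          (1 + spaceSq (v + s • a) / (v + s • a) 0)) := by ring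
      _ ≤ _ :=
        mul_le_mul_of_nonneg_left (heatKernel_line_le' ha hσ hρ hρσ hv hs) (by positivity)
  have h2 : ∀ i : Fin 3, |a i.succ * (heatDeriv i (v + s • a) - heatDeriv i v)| ≤
      3 * (ρ / σ) ^ 2 * (gaussianConst * gaussian v) := fun i => by
    rw [abs_mul]
    calc _ ≤ ρ * (3 * gaussianConst * ((ρ / σ ^ 2) * gaussian v)) :=
          mul_le_mul (ha.2 i) (abs_heatDeriv_sub_le (ha.smul hs) hσ hρ hρσ hv i)
            (abs_nonneg _) hρ
      _ = _ := by field_simp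
  have h3 : |∑ i : Fin 3, a i.succ * (heatDeriv i (v + s • a) - heatDeriv i v)| ≤
      3 * (3 * (ρ / σ) ^ 2 * (gaussianConst * gaussian v)) := by
    refine (Finset.abs_sum_le_sum_abs _ _).trans ?_
    simpa using Finset.sum_le_sum fun (i : Fin 3) (_ : i ∈ Finset.univ) => h2 i
  rw [e']
  refine (abs_add_le _ _).trans ((add_le_add h1 h3).trans (le_of_eq ?_))
  ring

end FarBounds

/-! ### Domination of increments of the heat kernel by an integrable kernel -/

/-- A kernel whose integral over `(0, T) × ℝ³` is finite for `κ > 0`. -/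
def majorant (κ : ℝ) (v : Spacetime) : ℝ :=
  if 0 < v 0 then v 0 ^ (κ / 2 - 5 / 2) * Real.exp (-spaceSq v / (20 * v 0)) else 0

lemma majorant_nonneg (κ : ℝ) (v : Spacetime) : 0 ≤ majorant κ v := by
  unfold majorant
  split_ifs
  · positivity
  · rfl

lemma gaussian_eq_majorant (κ : ℝ) {v : Spacetime} (hv : 0 < v 0) :
    gaussian v = v 0 ^ (1 - κ / 2) * majorant κ v := by
  rw [gaussian, majorant, if_pos hv, ← mul_assoc, ← Real.rpow_add hv]
  congr 2
  ring

lemma heatKernel_le_majorant (κ : ℝ) {v : Spacetime} (hv : 0 < v 0) :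
    heatKernel v ≤ gaussianConst * (v 0 ^ (1 - κ / 2) * majorant κ v) := by
  rw [← gaussian_eq_majorant κ hv]
  refine le_trans ?_ (heatKernel_mul_self_le_gaussian hv)
  have h : 0 ≤ spaceSq v / v 0 := div_nonneg (spaceSq_nonneg v) hv.le
  exact le_mul_of_one_le_right (heatKernel_nonneg v) (by nlinarith)

lemma abs_heatDeriv_le_majorant (κ : ℝ) {v : Spacetime} (hv : 0 < v 0) (i : Fin 3) :
    |heatDeriv i v| ≤ gaussianConst * (v 0 ^ ((1 - κ) / 2) * majorant κ v) := by
  have h : 0 ≤ spaceSq v / v 0 := div_nonneg (spaceSq_nonneg v) hv.le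
  have hsq : √(v 0) ^ 2 = v 0 := Real.sq_sqrt hv.le
  have hs : 0 < √(v 0) := Real.sqrt_pos.2 hv
  have h1 := abs_space_div_time_le hs (by rw [hsq]; linarith) i (w := v)
  have h2 : v 0 ^ ((1 - κ) / 2) * √(v 0) = v 0 ^ (1 - κ / 2) := by
    rw [Real.sqrt_eq_rpow, ← Real.rpow_add hv]
    congr 1
    ring
  have h3 := heatKernel_mul_self_le_gaussian hv
  rw [gaussian_eq_majorant κ hv, ← h2] at h3
  rw [heatDeriv, abs_mul, abs_neg, abs_div, abs_of_pos (show 0 < 2 * v 0 by positivity),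
    abs_of_nonneg (heatKernel_nonneg v)]
  have h4 : |v i.succ| / (2 * v 0) ≤ (1 + spaceSq v / v 0) ^ 2 / √(v 0) := by
    calc |v i.succ| / (2 * v 0) ≤ |v i.succ| / v 0 := by gcongr; linarith
      _ ≤ _ := h1
      _ ≤ _ := by gcongr; nlinarith
  calc |v i.succ| / (2 * v 0) * heatKernel v
      ≤ (1 + spaceSq v / v 0) ^ 2 / √(v 0) * heatKernel v :=
        mul_le_mul_of_nonneg_right h4 (heatKernel_nonneg v)
    _ = (heatKernel v * (1 + spaceSq v / v 0) ^ 2) / √(v 0) := by ring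
    _ ≤ _ := by rw [div_le_iff₀ hs]; linarith

/-- A gain of order m in ρ/σ is lowered to the order e ≤ m; the powers of σ then cancel and only ρ^e
remains. -/
lemma rpow_div_mul_le {ρ σ e m : ℝ} (hρ : 0 < ρ) (hσ : 0 < σ) (hρσ : ρ ≤ σ) (hem : e ≤ m) :
    (ρ / σ) ^ m * (σ ^ 2) ^ (e / 2) ≤ ρ ^ e := by
  have h1 : (σ ^ 2) ^ (e / 2) = σ ^ e := by
    rw [← Real.rpow_natCast, ← Real.rpow_mul hσ.le]; congr 1; push_cast; ring
  have h2 : (ρ / σ) ^ m ≤ (ρ / σ) ^ e :=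
    Real.rpow_le_rpow_of_exponent_ge (by positivity) ((div_le_one hσ).2 hρσ) hem
  rw [h1]
  calc _ ≤ (ρ / σ) ^ e * σ ^ e := by gcongr
    _ = ρ ^ e := by rw [← Real.mul_rpow (by positivity) hσ.le, div_mul_cancel₀ _ hσ.ne']

lemma rpow_half_le_of_le {t ρ e : ℝ} (ht : 0 < t) (hρ : 0 < ρ) (h : t ≤ 5 * ρ ^ 2) (he : 0 ≤ e)
    (he' : e ≤ 2) : t ^ (e / 2) ≤ 5 * ρ ^ e := by
  calc t ^ (e / 2) ≤ (5 * ρ ^ 2) ^ (e / 2) := by gcongr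
    _ = 5 ^ (e / 2) * ρ ^ e := by
      rw [Real.mul_rpow (by norm_num) (by positivity), ← Real.rpow_natCast, ← Real.rpow_mul hρ.le]
      congr 2; push_cast; ring
    _ ≤ 5 ^ (1 : ℝ) * ρ ^ e := by gcongr <;> linarith
    _ = _ := by rw [Real.rpow_one]

section

variable {κ ρ : ℝ} {v a : Spacetime}

/-- At times of order ρ² or less, the factor t^(1-κ/2) separating P from the majorant is itself of
order ρ^(2-κ), so no cancellation is needed. -/
lemma abs_heatKernel_near_le (hρ : 0 < ρ) (hκ0 : 0 ≤ κ) (hκ : κ ≤ 2) (hv : v 0 ≤ 5 * ρ ^ 2) :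
    |heatKernel v| ≤ 5 * gaussianConst * (ρ ^ (2 - κ) * majorant κ v) := by
  have hC := gaussianConst_pos
  have hM := majorant_nonneg κ v
  rcases lt_or_ge 0 (v 0) with h | h
  · rw [abs_of_nonneg (heatKernel_nonneg v)]
    have h1 := rpow_half_le_of_le h hρ hv (show 0 ≤ 2 - κ by linarith) (by linarith)
    rw [show (2 - κ) / 2 = 1 - κ / 2 by ring] at h1
    calc _ ≤ _ := heatKernel_le_majorant κ h
      _ ≤ gaussianConst * (5 * ρ ^ (2 - κ) * majorant κ v) := by gcongr
      _ = _ := by ring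
  · rw [heatKernel_of_nonpos h, abs_zero]; positivity

lemma abs_heatDeriv_near_le (hρ : 0 < ρ) (hκ0 : 0 ≤ κ) (hκ : κ ≤ 1) (hv : v 0 ≤ 5 * ρ ^ 2)
    (i : Fin 3) : |heatDeriv i v| ≤ 5 * gaussianConst * (ρ ^ (1 - κ) * majorant κ v) := by
  have hC := gaussianConst_pos
  have hM := majorant_nonneg κ v
  rcases lt_or_ge 0 (v 0) with h | h
  · have h1 := rpow_half_le_of_le h hρ hv (show 0 ≤ 1 - κ by linarith) (by linarith)
    calc _ ≤ _ := abs_heatDeriv_le_majorant κ h i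
      _ ≤ gaussianConst * (5 * ρ ^ (1 - κ) * majorant κ v) := by gcongr
      _ = _ := by ring
  · rw [heatDeriv_of_nonpos h, abs_zero]; positivity

lemma sqrt_facts (hρ : 0 < ρ) (hv : 4 * ρ ^ 2 ≤ v 0) :
    0 < √(v 0) ∧ 2 * ρ ≤ √(v 0) ∧ v 0 = √(v 0) ^ 2 := by
  have h0 : 0 < v 0 := lt_of_lt_of_le (by positivity) hv
  refine ⟨Real.sqrt_pos.2 h0, Real.le_sqrt_of_sq_le (by linarith), (Real.sq_sqrt h0.le).symm⟩

lemma time_add_le (ha : SmallShift ρ a) (hv : v 0 ≤ 4 * ρ ^ 2) : (v + a) 0 ≤ 5 * ρ ^ 2 := by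
  have := (abs_le.1 ha.1).2
  simp only [Pi.add_apply]
  linarith

/-- The constant in the bounds for the increments. -/
def incrementConst : ℝ := 30 * gaussianConst

lemma incrementConst_pos : 0 < incrementConst := mul_pos (by norm_num) gaussianConst_pos

/-- Used when the gradient has been projected away. A first-order gain ρ/σ is enough here because 2
- κ ≤ 1. -/
lemma abs_heatKernel_increment_le (hρ : 0 < ρ) (ha : SmallShift ρ a) (hκ : 1 ≤ κ) (hκ2 : κ ≤ 2) :
    |heatKernel (v + a) - heatKernel v| ≤
      incrementConst * (ρ ^ (2 - κ) * (majorant κ v + majorant κ (v + a))) := by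
  have hC := gaussianConst_pos
  have hM := majorant_nonneg κ v
  have hM' := majorant_nonneg κ (v + a)
  rw [incrementConst]
  rcases le_total (4 * ρ ^ 2) (v 0) with h | h
  · obtain ⟨hσ, hρσ, hv⟩ := sqrt_facts hρ h
    have hv0 : 0 < v 0 := lt_of_lt_of_le (by positivity) h
    have h1 := rpow_div_mul_le hρ hσ (show ρ ≤ √(v 0) by linarith) (show 2 - κ ≤ 1 by linarith)
    rw [← hv, Real.rpow_one, show (2 - κ) / 2 = 1 - κ / 2 by ring] at h1
    calc _ ≤ _ := abs_heatKernel_sub_le ha hσ hρ.le hρσ hv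
      _ = 3 * gaussianConst * ((ρ / √(v 0) * v 0 ^ (1 - κ / 2)) * majorant κ v) := by
        rw [gaussian_eq_majorant κ hv0]; ring
      _ ≤ 30 * gaussianConst * (ρ ^ (2 - κ) * (majorant κ v + majorant κ (v + a))) := by
        rw [mul_assoc 3, mul_assoc 30]
        gcongr
        · norm_num
        · linarith
  · have h1 := abs_heatKernel_near_le hρ (by linarith) hκ2 (show v 0 ≤ 5 * ρ ^ 2 by nlinarith)
    have h2 := abs_heatKernel_near_le hρ (by linarith) hκ2 (time_add_le ha h)
    have h3 : 0 ≤ gaussianConst * (ρ ^ (2 - κ) * (majorant κ v + majorant κ (v + a))) := by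
      positivity
    refine (abs_sub _ _).trans ?_
    linarith

lemma abs_heatDeriv_increment_le (hρ : 0 < ρ) (ha : SmallShift ρ a) (hκ : 0 ≤ κ) (hκ1 : κ ≤ 1)
    (i : Fin 3) : |heatDeriv i (v + a) - heatDeriv i v| ≤
      incrementConst * (ρ ^ (1 - κ) * (majorant κ v + majorant κ (v + a))) := by
  have hC := gaussianConst_pos
  have hM := majorant_nonneg κ v
  have hM' := majorant_nonneg κ (v + a)
  rw [incrementConst]
  rcases le_total (4 * ρ ^ 2) (v 0) with h | h
  · obtain ⟨hσ, hρσ, hv⟩ := sqrt_facts hρ h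
    have hv0 : 0 < v 0 := lt_of_lt_of_le (by positivity) h
    have h1 := rpow_div_mul_le hρ hσ (show ρ ≤ √(v 0) by linarith) (show 1 - κ ≤ 1 by linarith)
    rw [← hv, Real.rpow_one] at h1
    have h2 : v 0 ^ (1 - κ / 2) = √(v 0) * v 0 ^ ((1 - κ) / 2) := by
      rw [Real.sqrt_eq_rpow, ← Real.rpow_add hv0]
      congr 1
      ring
    calc _ ≤ _ := abs_heatDeriv_sub_le ha hσ hρ.le hρσ hv i
      _ = 3 * gaussianConst * ((ρ / √(v 0) * v 0 ^ ((1 - κ) / 2)) * majorant κ v) := by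
        rw [gaussian_eq_majorant κ hv0, h2]; field_simp
      _ ≤ 30 * gaussianConst * (ρ ^ (1 - κ) * (majorant κ v + majorant κ (v + a))) := by
        rw [mul_assoc 3, mul_assoc 30]
        gcongr
        · norm_num
        · linarith
  · have h1 := abs_heatDeriv_near_le hρ hκ hκ1 (show v 0 ≤ 5 * ρ ^ 2 by nlinarith) i
    have h2 := abs_heatDeriv_near_le hρ hκ hκ1 (time_add_le ha h) i
    have h3 : 0 ≤ gaussianConst * (ρ ^ (1 - κ) * (majorant κ v + majorant κ (v + a))) := by
      positivity
    refine (abs_sub _ _).trans ?_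
    linarith

lemma abs_heatKernel_taylor_increment_le (hρ : 0 < ρ) (ha : SmallShift ρ a) (hκ : 0 ≤ κ)
    (hκ1 : κ ≤ 1) :
    |heatKernel (v + a) - heatKernel v - ∑ i : Fin 3, a i.succ * heatDeriv i v| ≤
      incrementConst * (ρ ^ (2 - κ) * (majorant κ v + majorant κ (v + a))) := by
  have hC := gaussianConst_pos
  have hM := majorant_nonneg κ v
  have hM' := majorant_nonneg κ (v + a)
  rw [incrementConst]
  -- Far from the singularity the Taylor bound of order two applies; near it the terms are estimated
  -- one by one, both times being at most 5ρ².
  rcases le_total (4 * ρ ^ 2) (v 0) with h | h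
  · obtain ⟨hσ, hρσ, hv⟩ := sqrt_facts hρ h
    have hv0 : 0 < v 0 := lt_of_lt_of_le (by positivity) h
    have h1 := rpow_div_mul_le hρ hσ (show ρ ≤ √(v 0) by linarith) (show 2 - κ ≤ 2 by linarith)
    rw [← hv, Real.rpow_two, show (2 - κ) / 2 = 1 - κ / 2 by ring] at h1
    calc _ ≤ _ := abs_heatKernel_taylor_le ha hσ hρ.le hρσ hv
      _ = 11 * gaussianConst * (((ρ / √(v 0)) ^ 2 * v 0 ^ (1 - κ / 2)) * majorant κ v) := by
        rw [gaussian_eq_majorant κ hv0]; ring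
      _ ≤ 30 * gaussianConst * (ρ ^ (2 - κ) * (majorant κ v + majorant κ (v + a))) := by
        rw [mul_assoc 11, mul_assoc 30]
        gcongr
        · norm_num
        · linarith
  · have hv5 : v 0 ≤ 5 * ρ ^ 2 := by nlinarith
    have h1 := abs_heatKernel_near_le hρ hκ (by linarith) hv5
    have h2 := abs_heatKernel_near_le hρ hκ (by linarith) (time_add_le ha h)
    have h3 : ∀ i : Fin 3, |a i.succ * heatDeriv i v| ≤
        5 * gaussianConst * (ρ ^ (2 - κ) * majorant κ v) := fun i => by
      rw [abs_mul, show (2 - κ) = 1 + (1 - κ) by ring, Real.rpow_add hρ, Real.rpow_one]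
      calc _ ≤ ρ * (5 * gaussianConst * (ρ ^ (1 - κ) * majorant κ v)) :=
            mul_le_mul (ha.2 i) (abs_heatDeriv_near_le hρ hκ hκ1 hv5 i) (abs_nonneg _) hρ.le
        _ = _ := by ring
    have h4 : |∑ i : Fin 3, a i.succ * heatDeriv i v| ≤
        3 * (5 * gaussianConst * (ρ ^ (2 - κ) * majorant κ v)) := by
      refine (Finset.abs_sum_le_sum_abs _ _).trans ?_
      simpa using Finset.sum_le_sum fun (i : Fin 3) (_ : i ∈ Finset.univ) => h3 i
    have h5 : 0 ≤ gaussianConst * (ρ ^ (2 - κ) * majorant κ v) := by positivity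
    have h6 : 0 ≤ gaussianConst * (ρ ^ (2 - κ) * majorant κ (v + a)) := by positivity
    refine (abs_sub _ _).trans ((add_le_add_left (abs_sub _ _) _).trans ?_)
    linarith

end

lemma scaledNorm_nonneg (a : Spacetime) : 0 ≤ scaledNorm a :=
  (Real.rpow_nonneg (abs_nonneg _) _).trans
    (Finset.le_sup' (fun i => |a i| ^ (1 / (scaling i : ℝ))) (Finset.mem_univ 0))

lemma smallShift_scaledNorm (a : Spacetime) : SmallShift (scaledNorm a) a := by
  have h := fun i => Finset.le_sup' (fun i => |a i| ^ (1 / (scaling i : ℝ))) (Finset.mem_univ i)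
  refine ⟨?_, fun i => ?_⟩
  · have h0 : |a 0| ^ (1 / ((2 : ℕ) : ℝ)) ≤ scaledNorm a := h 0
    calc |a 0| = (|a 0| ^ (1 / ((2 : ℕ) : ℝ))) ^ 2 := by
          rw [← Real.rpow_natCast, ← Real.rpow_mul (abs_nonneg _)]; norm_num
      _ ≤ _ := by gcongr
  · have h1 : |a i.succ| ^ (1 / (scaling i.succ : ℝ)) ≤ scaledNorm a := h i.succ
    rwa [scaling_succ, Nat.cast_one, one_div_one, Real.rpow_one] at h1

/-! ### Periodic functions and the unit cell -/

/-- `ℝ × [0, 1)³`. -/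
def unitCell : Set Spacetime := {z | ∀ i : Fin 3, 0 ≤ z i.succ ∧ z i.succ < 1}

/-- The lattice `{0} × ℤ³`. -/
def lattice : AddSubgroup Spacetime where
  carrier := range latticeShift
  zero_mem' := ⟨0, by ext j; refine Fin.cases ?_ (fun i => ?_) j <;> simp [latticeShift]⟩
  add_mem' := by
    rintro _ _ ⟨m, rfl⟩ ⟨n, rfl⟩
    exact ⟨m + n, by ext j; refine Fin.cases ?_ (fun i => ?_) j <;> simp [latticeShift]⟩
  neg_mem' := by
    rintro _ ⟨m, rfl⟩
    exact ⟨-m, by ext j; refine Fin.cases ?_ (fun i => ?_) j <;> simp [latticeShift]⟩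

instance : Countable lattice := (countable_range latticeShift).to_subtype

lemma latticeShift_zero_time (n : Fin 3 → ℤ) : latticeShift n 0 = 0 := rfl

lemma latticeShift_succ (n : Fin 3 → ℤ) (i : Fin 3) : latticeShift n i.succ = n i := rfl

lemma measurableSet_unitCell : MeasurableSet unitCell := by
  simp only [unitCell, ofPred_forall, ofPred_and]
  exact .iInter fun i => (measurableSet_le measurable_const (measurable_pi_apply _)).inter
    (measurableSet_lt (measurable_pi_apply _) measurable_const)

lemma measurableSet_strip (T : ℝ) : MeasurableSet (strip T) :=
  (measurableSet_lt measurable_const (measurable_pi_apply _)).inter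
    (measurableSet_lt (measurable_pi_apply _) measurable_const)

lemma torusSlab_eq (a b : ℝ) : torusSlab a b = {z | a < z 0 ∧ z 0 < b} ∩ unitCell := by
  ext z; simp [torusSlab, unitCell, and_assoc]

lemma torusSlab_zero_eq (T : ℝ) : torusSlab 0 T = strip T ∩ unitCell := torusSlab_eq 0 T

lemma measurableSet_torusSlab (a b : ℝ) : MeasurableSet (torusSlab a b) := by
  rw [torusSlab_eq]
  exact ((measurableSet_lt measurable_const (measurable_pi_apply _)).inter
    (measurableSet_lt (measurable_pi_apply _) measurable_const)).inter measurableSet_unitCell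

lemma add_latticeShift_mem_strip {T : ℝ} {z : Spacetime} (n : Fin 3 → ℤ) :
    z + latticeShift n ∈ strip T ↔ z ∈ strip T := by
  simp [strip, latticeShift_zero_time]

lemma existsUnique_mem_unitCell_sub (v z : Spacetime) :
    ∃! g : lattice, g +ᵥ z ∈ {y | y - v ∈ unitCell} := by
  refine ⟨⟨latticeShift fun i => -⌊(z - v) i.succ⌋, mem_range_self _⟩, ?_, ?_⟩
  · intro i
    have h1 := Int.floor_le ((z - v) i.succ)
    have h2 := Int.lt_floor_add_one ((z - v) i.succ)
    simp only [Pi.sub_apply] at h1 h2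
    simp only [AddSubgroup.vadd_def, vadd_eq_add, Pi.sub_apply, Pi.add_apply, latticeShift_succ]
    push_cast
    constructor <;> linarith
  · rintro ⟨_, n, rfl⟩ h
    congr 2
    ext i
    have h1 := h i
    simp only [AddSubgroup.vadd_def, vadd_eq_add, Pi.sub_apply, Pi.add_apply,
      latticeShift_succ] at h1
    have : ⌊(z - v) i.succ⌋ = -n i := by
      rw [Int.floor_eq_iff]
      simp only [Pi.sub_apply]
      push_cast
      constructor <;> linarith
    rw [this, neg_neg]

lemma isAddFundamentalDomain_unitCell_sub (v : Spacetime) :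
    IsAddFundamentalDomain lattice {y | y - v ∈ unitCell} (volume : Measure Spacetime) :=
  .mk' ((measurableSet_unitCell.preimage (measurable_sub_const v)).nullMeasurableSet)
    (existsUnique_mem_unitCell_sub v)

/-- The integral of a periodic function over the unit cell is translation invariant. -/
lemma lintegral_unitCell_add (g : Spacetime → ℝ≥0∞)
    (hg : ∀ z n, g (z + latticeShift n) = g z) (v : Spacetime) :
    ∫⁻ z in unitCell, g (z + v) = ∫⁻ z in unitCell, g z := by
  have hm : MeasurableSet {y : Spacetime | y - v ∈ unitCell} :=
    measurableSet_unitCell.preimage (measurable_sub_const v)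
  have h1 : ∫⁻ z in unitCell, g (z + v) = ∫⁻ z in {y | y - v ∈ unitCell}, g z := by
    rw [← lintegral_indicator measurableSet_unitCell,
      ← lintegral_indicator hm,
      ← lintegral_add_right_eq_self ({y | y - v ∈ unitCell}.indicator g) v]
    congr 1 with z
    have hz : z + v ∈ {y : Spacetime | y - v ∈ unitCell} ↔ z ∈ unitCell := by
      change z + v - v ∈ unitCell ↔ _
      rw [add_sub_cancel_right]
    by_cases h : z ∈ unitCell
    · rw [indicator_of_mem h, indicator_of_mem (hz.2 h)]
    · rw [indicator_of_notMem h, indicator_of_notMem (mt hz.1 h)]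
  have h0 : IsAddFundamentalDomain lattice unitCell (volume : Measure Spacetime) := by
    simpa using isAddFundamentalDomain_unitCell_sub 0
  rw [h1]
  refine (isAddFundamentalDomain_unitCell_sub v).setLIntegral_eq h0 g ?_
  rintro ⟨_, n, rfl⟩ z
  rw [AddSubgroup.vadd_def, vadd_eq_add, add_comm]
  exact hg z n

lemma iUnion_unitCell_translate (T : ℝ) :
    strip T = ⋃ n : Fin 3 → ℤ, (fun z => z + latticeShift n) ⁻¹' torusSlab 0 T := by
  ext z
  simp only [mem_iUnion, mem_preimage, torusSlab_zero_eq, mem_inter_iff, add_latticeShift_mem_strip,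
    exists_and_left, iff_self_and]
  intro _
  obtain ⟨⟨_, n, rfl⟩, h, -⟩ := existsUnique_mem_unitCell_sub 0 z
  refine ⟨n, ?_⟩
  simpa [AddSubgroup.vadd_def, add_comm] using h

lemma measurePreserving_latticeShift (T : ℝ) (n : Fin 3 → ℤ) :
    MeasurePreserving (fun z => z + latticeShift n)
      (volume.restrict ((fun z => z + latticeShift n) ⁻¹' torusSlab 0 T))
      (volume.restrict (torusSlab 0 T)) :=
  (measurePreserving_add_right volume (latticeShift n)).restrict_preimage
    (measurableSet_torusSlab 0 T)

/-- The hypothesis on h concerns one period only, whereas the pairings integrate over the whole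
strip; countably many lattice translates of the slab cover it. -/
lemma aestronglyMeasurable_strip {T : ℝ} {h : Spacetime → ℝ} (hper : IsPeriodic T h)
    (hm : AEStronglyMeasurable h (volume.restrict (torusSlab 0 T))) :
    AEStronglyMeasurable h (volume.restrict (strip T)) := by
  rw [iUnion_unitCell_translate, aestronglyMeasurable_iUnion_iff]
  intro n
  refine (hm.comp_measurePreserving (measurePreserving_latticeShift T n)).congr ?_
  refine (ae_restrict_iff' ((measurableSet_torusSlab 0 T).preimage (measurable_add_const _))).2
    (.of_forall fun z hz => hper z ?_ n)
  rw [mem_preimage, torusSlab_zero_eq] at hz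
  exact (add_latticeShift_mem_strip n).1 hz.1

lemma ae_strip_of_ae_unitCell {T : ℝ} {p : Spacetime → Prop}
    (hp : ∀ z n, p (z + latticeShift n) ↔ p z)
    (h : ∀ᵐ z ∂(volume.restrict unitCell), p z) : ∀ᵐ z ∂(volume.restrict (strip T)), p z := by
  rw [iUnion_unitCell_translate, ae_restrict_iUnion_iff]
  intro n
  have h1 : ∀ᵐ z ∂(volume.restrict (torusSlab 0 T)), p z := by
    rw [torusSlab_zero_eq]
    exact ae_restrict_of_ae_restrict_of_subset inter_subset_right h
  filter_upwards [(measurePreserving_latticeShift T n).quasiMeasurePreserving.ae h1] with z hz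
  exact (hp z n).1 hz

/-! ### Integrability of the majorant -/

lemma measurable_spaceSq : Measurable spaceSq := by unfold spaceSq; fun_prop

lemma measurable_majorant (κ : ℝ) : Measurable (majorant κ) := by
  have := measurable_spaceSq
  refine Measurable.ite (measurableSet_lt measurable_const (measurable_pi_apply 0)) ?_
    measurable_const
  fun_prop

lemma measurable_heatKernel : Measurable heatKernel := by
  refine Measurable.ite (measurableSet_lt measurable_const (measurable_pi_apply 0)) ?_
    measurable_const
  fun_prop

lemma measurable_heatDeriv (i : Fin 3) : Measurable (heatDeriv i) := by
  have := measurable_heatKernel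
  unfold heatDeriv
  fun_prop

/-- The majorant, restricted to times less than `T`. -/
def cutMajorant (κ T : ℝ) (v : Spacetime) : ℝ≥0∞ :=
  if v 0 < T then ENNReal.ofReal (majorant κ v) else 0

lemma measurable_cutMajorant (κ T : ℝ) : Measurable (cutMajorant κ T) :=
  Measurable.ite (measurableSet_lt (measurable_pi_apply 0) measurable_const)
    (measurable_majorant κ).ennreal_ofReal measurable_const

lemma lintegral_gaussian_space {t : ℝ} (ht : 0 < t) :
    ∫⁻ x : Fin 3 → ℝ, ENNReal.ofReal (Real.exp (-(∑ i, x i ^ 2) / (20 * t))) =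
      ENNReal.ofReal ((20 * Real.pi) ^ (3 / 2 : ℝ) * t ^ (3 / 2 : ℝ)) := by
  have hb : 0 < (20 * t)⁻¹ := by positivity
  have h1 : ∀ x : Fin 3 → ℝ, Real.exp (-(∑ i, x i ^ 2) / (20 * t)) =
      ∏ i, Real.exp (-(20 * t)⁻¹ * x i ^ 2) := fun x => by
    rw [← Real.exp_sum, ← Finset.mul_sum]
    congr 1
    ring
  have hint : Integrable fun x : Fin 3 → ℝ => ∏ i, Real.exp (-(20 * t)⁻¹ * x i ^ 2) :=
    Integrable.fintype_prod fun _ => integrable_exp_neg_mul_sq hb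
  simp only [h1]
  rw [← ofReal_integral_eq_lintegral_ofReal hint (.of_forall fun x => by positivity),
    integral_fintype_prod_volume_eq_pow (fun y : ℝ => Real.exp (-(20 * t)⁻¹ * y ^ 2)),
    integral_gaussian, Fintype.card_fin, ← Real.mul_rpow (by positivity) ht.le,
    Real.sqrt_eq_rpow, ← Real.rpow_natCast, ← Real.rpow_mul (by positivity)]
  congr 2
  · rw [div_inv_eq_mul]; ring
  · norm_num

/-- Space integration of the Gaussian contributes t^(3/2), which turns t^(κ/2-5/2) into t^(κ/2-1);
its exponent exceeds -1 exactly when κ > 0. -/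
lemma lintegral_cutMajorant_lt_top {κ : ℝ} (hκ : 0 < κ) (T : ℝ) :
    ∫⁻ v, cutMajorant κ T v < ⊤ := by
  have hvol := (volume_preserving_piFinSuccAbove (fun _ : Fin 4 => ℝ) 0).symm
  rw [← hvol.lintegral_comp (measurable_cutMajorant κ T), Measure.volume_eq_prod,
    
    lintegral_prod (fun p => cutMajorant κ T
      ((MeasurableEquiv.piFinSuccAbove (fun _ : Fin 4 => ℝ) 0).symm p))
      ((measurable_cutMajorant κ T).comp hvol.measurable).aemeasurable]
  have h1 : ∀ t : ℝ, ∫⁻ x : Fin 3 → ℝ, cutMajorant κ T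
      ((MeasurableEquiv.piFinSuccAbove (fun _ : Fin 4 => ℝ) 0).symm (t, x)) =
      (Ioo 0 T).indicator (fun t => ENNReal.ofReal ((20 * Real.pi) ^ (3 / 2 : ℝ) *
        t ^ (κ / 2 - 1))) t := by
    intro t
    have e : ∀ x : Fin 3 → ℝ, cutMajorant κ T
        ((MeasurableEquiv.piFinSuccAbove (fun _ : Fin 4 => ℝ) 0).symm (t, x)) =
        (Ioo 0 T).indicator (fun t => ENNReal.ofReal (t ^ (κ / 2 - 5 / 2)) *
          ENNReal.ofReal (Real.exp (-(∑ i, x i ^ 2) / (20 * t)))) t := by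
      intro x
      have hy : ((MeasurableEquiv.piFinSuccAbove (fun _ : Fin 4 => ℝ) 0).symm (t, x)) 0 = t := rfl
      have hS : spaceSq ((MeasurableEquiv.piFinSuccAbove (fun _ : Fin 4 => ℝ) 0).symm (t, x)) =
        ∑ i, x i ^ 2 := rfl
      rw [cutMajorant, majorant, hy, hS]
      by_cases h0 : 0 < t
      · by_cases hT : t < T
        · simp only [indicator, h0, hT, mem_Ioo, and_self, if_true]
          exact ENNReal.ofReal_mul (Real.rpow_nonneg h0.le _)
        · simp [indicator, hT]
      · simp [indicator, h0]
    simp only [e]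
    by_cases ht : t ∈ Ioo 0 T
    · simp only [indicator_of_mem ht]
      rw [lintegral_const_mul' _ _ ENNReal.ofReal_ne_top, lintegral_gaussian_space ht.1,
        ← ENNReal.ofReal_mul (Real.rpow_nonneg ht.1.le _), mul_left_comm, ← Real.rpow_add ht.1]
      congr 3
      ring
    · simp [indicator_of_notMem ht]
  simp only [h1]
  rw [lintegral_indicator measurableSet_Ioo]
  rcases le_or_gt T 0 with hT | hT
  · simp [Ioo_eq_empty (not_lt.2 hT)]
  have h2 : IntegrableOn (fun t : ℝ => (20 * Real.pi) ^ (3 / 2 : ℝ) * t ^ (κ / 2 - 1)) (Ioo 0 T) :=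
    ((intervalIntegral.integrableOn_Ioo_rpow_iff hT).2 (by linarith)).const_mul _
  exact (hasFiniteIntegral_iff_ofReal ((ae_restrict_iff' measurableSet_Ioo).2
    (.of_forall fun t ht => mul_nonneg (by positivity) (Real.rpow_nonneg ht.1.le _)))).1
    h2.hasFiniteIntegral

/-! ### Young's inequality for periodic functions -/

/-- Cauchy–Schwarz for the splitting k f = k^(1/2) · (k^(1/2) f). -/
lemma sq_lintegral_mul_le {α : Type*} [MeasurableSpace α] (μ : Measure α) {k f : α → ℝ≥0∞}
    (hk : AEMeasurable k μ) (hf : AEMeasurable f μ) :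
    (∫⁻ x, k x * f x ∂μ) ^ 2 ≤ (∫⁻ x, k x ∂μ) * ∫⁻ x, k x * f x ^ 2 ∂μ := by
  have h := ENNReal.lintegral_mul_le_Lp_mul_Lq μ Real.HolderConjugate.two_two
    (hk.pow_const (1 / 2 : ℝ)) ((hk.pow_const (1 / 2 : ℝ)).mul hf)
  have e1 : ∀ x, k x ^ (1 / 2 : ℝ) * k x ^ (1 / 2 : ℝ) = k x := fun x => by
    rw [← ENNReal.rpow_add_of_nonneg _ _ (by norm_num) (by norm_num)]; norm_num
  have e2 : ∀ y : ℝ≥0∞, (y ^ (1 / 2 : ℝ)) ^ 2 = y := fun y => by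
    rw [← ENNReal.rpow_natCast, ← ENNReal.rpow_mul]; norm_num
  simp only [Pi.mul_apply, ← mul_assoc, e1, ENNReal.rpow_two, mul_pow, e2] at h
  calc _ ≤ ((∫⁻ x, k x ∂μ) ^ (1 / 2 : ℝ) * (∫⁻ x, k x * f x ^ 2 ∂μ) ^ (1 / 2 : ℝ)) ^ 2 := by
        gcongr
    _ = _ := by rw [mul_pow, e2, e2]

/-- The convolution of two functions on space-time. -/
def conv (H K : Spacetime → ℝ≥0∞) (z : Spacetime) : ℝ≥0∞ := ∫⁻ w, H w * K (z - w)

lemma conv_eq (H K : Spacetime → ℝ≥0∞) (z : Spacetime) :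
    conv H K z = ∫⁻ v, K v * H (z - v) := by
  rw [conv, ← lintegral_sub_left_eq_self _ z]
  simp [mul_comm]

lemma conv_periodic {H : Spacetime → ℝ≥0∞} (hH : ∀ z n, H (z + latticeShift n) = H z)
    (K : Spacetime → ℝ≥0∞) (z : Spacetime) (n : Fin 3 → ℤ) :
    conv H K (z + latticeShift n) = conv H K z := by
  rw [conv_eq, conv_eq]
  simp only [add_sub_right_comm, hH]

lemma aemeasurable_comp_sub {H : Spacetime → ℝ≥0∞} (hH : AEMeasurable H) :
    AEMeasurable (fun p : Spacetime × Spacetime => H (p.1 - p.2)) :=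
  hH.comp_quasiMeasurePreserving (quasiMeasurePreserving_sub_of_right_invariant volume volume)

lemma aemeasurable_conv {H K : Spacetime → ℝ≥0∞} (hH : AEMeasurable H) (hK : Measurable K) :
    AEMeasurable (conv H K) := by
  have : AEMeasurable (fun p : Spacetime × Spacetime => H p.2 * K (p.1 - p.2))
      (volume.prod volume) :=
    (hH.comp_snd).mul (hK.comp (by fun_prop)).aemeasurable
  exact this.lintegral_prod_right'

/-- Only H is periodic: K lives on the full space and enters through its L¹ norm. The weighted
Cauchy–Schwarz inequality and Tonelli reduce the claim to translation invariance of ∫ H² over a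
cell. -/
lemma lintegral_conv_sq_le {H K : Spacetime → ℝ≥0∞} (hH : AEMeasurable H) (hK : Measurable K)
    (hper : ∀ z n, H (z + latticeShift n) = H z) :
    ∫⁻ z in unitCell, conv H K z ^ 2 ≤ (∫⁻ v, K v) ^ 2 * ∫⁻ z in unitCell, H z ^ 2 := by
  have hHz : ∀ z, AEMeasurable (fun v => H (z - v)) := fun z =>
    hH.comp_quasiMeasurePreserving (quasiMeasurePreserving_sub_left volume z)
  have hm : AEMeasurable (fun p : Spacetime × Spacetime => K p.2 * H (p.1 - p.2) ^ 2)
      (((volume : Measure Spacetime).restrict unitCell).prod volume) := by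
    refine AEMeasurable.mono_ac (ν := (volume : Measure Spacetime).prod volume) ?_
      (Measure.restrict_le_self.absolutelyContinuous.prod .rfl)
    exact (hK.comp measurable_snd).aemeasurable.mul ((aemeasurable_comp_sub hH).pow_const 2)
  calc ∫⁻ z in unitCell, conv H K z ^ 2
      ≤ ∫⁻ z in unitCell, (∫⁻ v, K v) * ∫⁻ v, K v * H (z - v) ^ 2 := by
        refine lintegral_mono fun z => ?_
        rw [conv_eq]
        exact sq_lintegral_mul_le volume hK.aemeasurable (hHz z)
    _ = (∫⁻ v, K v) * ∫⁻ z in unitCell, ∫⁻ v, K v * H (z - v) ^ 2 :=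
        lintegral_const_mul'' _ hm.lintegral_prod_right'
    _ = (∫⁻ v, K v) * ∫⁻ v, ∫⁻ z in unitCell, K v * H (z - v) ^ 2 := by
        rw [lintegral_lintegral_swap hm]
    _ = (∫⁻ v, K v) * ∫⁻ v, K v * ∫⁻ z in unitCell, H z ^ 2 := by
        congr 1
        refine lintegral_congr fun v => ?_
        rw [← lintegral_unitCell_add (fun z => H z ^ 2) (fun z n => by rw [hper]) (-v),
          lintegral_const_mul'']
        · simp only [sub_eq_add_neg]
        · exact ((hH.comp_quasiMeasurePreserving
            (measurePreserving_sub_right volume v).quasiMeasurePreserving).pow_const 2).restrict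
    _ = _ := by rw [lintegral_mul_const _ hK]; ring

/-! ### Pointwise bounds for the heat pairings -/

/-- `|h|` on the strip, extended by zero. -/
def cutoff (T : ℝ) (h : Spacetime → ℝ) : Spacetime → ℝ≥0∞ := (strip T).indicator fun z => ‖h z‖ₑ

/-- The convolution of `|h|` with the majorant. -/
def maximal (κ T : ℝ) (h : Spacetime → ℝ) : Spacetime → ℝ≥0∞ := conv (cutoff T h) (cutMajorant κ T)

section

variable {κ T : ℝ} {h : Spacetime → ℝ}

lemma cutoff_periodic (hper : IsPeriodic T h) (z : Spacetime) (n : Fin 3 → ℤ) :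
    cutoff T h (z + latticeShift n) = cutoff T h z := by
  by_cases hz : z ∈ strip T
  · rw [cutoff, indicator_of_mem hz, indicator_of_mem ((add_latticeShift_mem_strip n).2 hz),
      hper z hz n]
  · rw [cutoff, indicator_of_notMem hz,
      indicator_of_notMem (mt (add_latticeShift_mem_strip n).1 hz)]

lemma maximal_periodic (hper : IsPeriodic T h) (z : Spacetime) (n : Fin 3 → ℤ) :
    maximal κ T h (z + latticeShift n) = maximal κ T h z :=
  conv_periodic (cutoff_periodic hper) _ z n

lemma aemeasurable_cutoff (hm : AEStronglyMeasurable h (volume.restrict (strip T))) :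
    AEMeasurable (cutoff T h) :=
  (aemeasurable_indicator_iff (measurableSet_strip T)).2 hm.enorm

lemma aemeasurable_maximal (hm : AEStronglyMeasurable h (volume.restrict (strip T))) :
    AEMeasurable (maximal κ T h) :=
  aemeasurable_conv (aemeasurable_cutoff hm) (measurable_cutMajorant κ T)

lemma lintegral_maximal_sq_lt_top (hκ : 0 < κ) (hper : IsPeriodic T h)
    (hL2 : MemLp h 2 (volume.restrict (torusSlab 0 T))) :
    ∫⁻ z in unitCell, maximal κ T h z ^ 2 < ⊤ := by
  have hm := aemeasurable_cutoff (aestronglyMeasurable_strip hper hL2.1)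
  refine (lintegral_conv_sq_le hm (measurable_cutMajorant κ T) (cutoff_periodic hper)).trans_lt ?_
  refine ENNReal.mul_lt_top (ENNReal.pow_lt_top (lintegral_cutMajorant_lt_top hκ T)) ?_
  have h1 : ∀ z, cutoff T h z ^ 2 = (strip T).indicator (fun z => ‖h z‖ₑ ^ 2) z := fun z => by
    by_cases hz : z ∈ strip T <;> simp [cutoff, hz]
  simp only [h1]
  rw [lintegral_indicator (measurableSet_strip T), Measure.restrict_restrict (measurableSet_strip T),
    ← torusSlab_zero_eq]
  have h2 := lintegral_rpow_enorm_lt_top_of_eLpNorm_lt_top two_ne_zero ENNReal.ofNat_ne_top hL2.2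
  simpa using h2

lemma lintegral_mul_le_maximal {z z' : Spacetime} (hz : z 0 < T) (hz' : z' 0 < T) {c : ℝ}
    (hc : 0 ≤ c) (hm : AEStronglyMeasurable h (volume.restrict (strip T))) {k : Spacetime → ℝ}
    (hk : ∀ w ∈ strip T, |k w| ≤ c * (majorant κ (z - w) + majorant κ (z' - w))) :
    ∫⁻ w in strip T, ‖h w * k w‖ₑ ≤
      ENNReal.ofReal c * (maximal κ T h z + maximal κ T h z') := by
  have hK : ∀ y : Spacetime, Measurable fun w => cutMajorant κ T (y - w) := fun y =>
    (measurable_cutMajorant κ T).comp (measurable_const_sub y)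
  have hHK : ∀ y : Spacetime, AEMeasurable fun w => cutoff T h w * cutMajorant κ T (y - w) :=
    fun y => (aemeasurable_cutoff hm).mul (hK y).aemeasurable
  rw [maximal, conv, conv, ← lintegral_add_left' (hHK z),
    ← lintegral_const_mul' _ _ ENNReal.ofReal_ne_top,
    ← lintegral_indicator (measurableSet_strip T)]
  refine lintegral_mono fun w => ?_
  by_cases hw : w ∈ strip T
  -- Since w₀ > 0, the difference y - w has time less than T, so the cutoff in `cutMajorant` loses
  -- nothing.
  · have hcut : ∀ y : Spacetime, y 0 < T →
        cutMajorant κ T (y - w) = ENNReal.ofReal (majorant κ (y - w)) := fun y hy => by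
      rw [cutMajorant, if_pos]
      have := hw.1
      simp only [Pi.sub_apply]
      linarith
    rw [indicator_of_mem hw, hcut z hz, hcut z' hz', cutoff, indicator_of_mem hw, enorm_mul,
      ← mul_add, ← ENNReal.ofReal_add (majorant_nonneg _ _) (majorant_nonneg _ _), mul_left_comm,
      ← ENNReal.ofReal_mul hc, Real.enorm_eq_ofReal_abs (k w)]
    gcongr
    exact hk w hw
  · rw [indicator_of_notMem hw]
    exact zero_le

lemma lintegral_mul_le_maximal_self {z : Spacetime} (hz : z 0 < T) {c : ℝ}
    (hc : 0 ≤ c) (hm : AEStronglyMeasurable h (volume.restrict (strip T))) {k : Spacetime → ℝ}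
    (hk : ∀ w ∈ strip T, |k w| ≤ c * majorant κ (z - w)) :
    ∫⁻ w in strip T, ‖h w * k w‖ₑ ≤ ENNReal.ofReal c * maximal κ T h z := by
  -- Both base points are taken equal to z, with half the constant.
  have h1 := lintegral_mul_le_maximal (κ := κ) hz hz (by positivity : 0 ≤ c / 2) hm (k := k)
    fun w hw =>
    (hk w hw).trans (by linarith)
  rw [← two_mul, ← mul_assoc, ← ENNReal.ofReal_ofNat 2, ← ENNReal.ofReal_mul (by positivity)] at h1
  simpa using h1

lemma integrableOn_of_abs_le {z : Spacetime} (hz : z 0 < T) {c : ℝ} (hc : 0 ≤ c)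
    (hm : AEStronglyMeasurable h (volume.restrict (strip T))) {k : Spacetime → ℝ}
    (hkm : Measurable k) (hk : ∀ v : Spacetime, 0 < v 0 → v 0 < T → |k v| ≤ c * majorant κ v)
    (hk0 : ∀ v : Spacetime, v 0 ≤ 0 → k v = 0) (hfin : maximal κ T h z ≠ ⊤) :
    IntegrableOn (fun w => h w * k (z - w)) (strip T) := by
  refine ⟨hm.mul (hkm.comp (measurable_const_sub z)).aestronglyMeasurable, ?_⟩
  refine (lintegral_mul_le_maximal_self (κ := κ) hz hc hm (k := fun w => k (z - w))
    fun w hw => ?_).trans_lt (ENNReal.mul_lt_top ENNReal.ofReal_lt_top hfin.lt_top)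
  rcases lt_or_ge 0 ((z - w) 0) with hv | hv
  · refine hk _ hv ?_
    have := hw.1
    simp only [Pi.sub_apply]
    linarith
  · rw [hk0 _ hv, abs_zero]
    exact mul_nonneg hc (majorant_nonneg _ _)

/-- The bound τ on the time is taken to be T for integrability and z₀ for the weighted local bound;
the latter choice produces the power of t. -/
lemma heatKernel_le_of_lt {τ : ℝ} (hκ : κ ≤ 2) {v : Spacetime} (hv : v 0 ≤ τ) (hτ : 0 < τ) :
    |heatKernel v| ≤ gaussianConst * τ ^ ((2 - κ) / 2) * majorant κ v := by
  have hC := gaussianConst_pos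
  have hM := majorant_nonneg κ v
  rcases lt_or_ge 0 (v 0) with h0 | h0
  · rw [abs_of_nonneg (heatKernel_nonneg v), mul_assoc, show (2 - κ) / 2 = 1 - κ / 2 by ring]
    refine (heatKernel_le_majorant κ h0).trans ?_
    gcongr
    linarith
  · rw [heatKernel_of_nonpos h0, abs_zero]
    positivity

lemma abs_heatDeriv_le_of_lt {τ : ℝ} (hκ : κ ≤ 1) {v : Spacetime} (hv : v 0 ≤ τ) (hτ : 0 < τ)
    (i : Fin 3) : |heatDeriv i v| ≤ gaussianConst * τ ^ ((1 - κ) / 2) * majorant κ v := by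
  have hC := gaussianConst_pos
  have hM := majorant_nonneg κ v
  rcases lt_or_ge 0 (v 0) with h0 | h0
  · rw [mul_assoc]
    refine (abs_heatDeriv_le_majorant κ h0 i).trans ?_
    gcongr
  · rw [heatDeriv_of_nonpos h0, abs_zero]
    positivity

lemma integrableOn_heatKernel (hκ : κ ≤ 2) {z : Spacetime} (hz : z ∈ strip T)
    (hm : AEStronglyMeasurable h (volume.restrict (strip T))) (hfin : maximal κ T h z ≠ ⊤) :
    IntegrableOn (fun w => h w * heatKernel (z - w)) (strip T) :=
  have hT : 0 < T := hz.1.trans hz.2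
  integrableOn_of_abs_le hz.2 (mul_nonneg gaussianConst_pos.le (Real.rpow_nonneg hT.le _)) hm
    measurable_heatKernel (fun _ _ hv => heatKernel_le_of_lt hκ hv.le hT)
    (fun _ hv => heatKernel_of_nonpos hv) hfin

lemma integrableOn_heatDeriv (hκ : κ ≤ 1) {z : Spacetime} (hz : z ∈ strip T)
    (hm : AEStronglyMeasurable h (volume.restrict (strip T))) (hfin : maximal κ T h z ≠ ⊤)
    (i : Fin 3) : IntegrableOn (fun w => h w * heatDeriv i (z - w)) (strip T) :=
  have hT : 0 < T := hz.1.trans hz.2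
  integrableOn_of_abs_le hz.2 (mul_nonneg gaussianConst_pos.le (Real.rpow_nonneg hT.le _)) hm
    (measurable_heatDeriv i) (fun _ _ hv => abs_heatDeriv_le_of_lt hκ hv.le hT i)
    (fun _ hv => heatDeriv_of_nonpos hv i) hfin

/-- The coefficient `⟨h, P(z - ·)⟩` of `1`. -/
def heatValue (T : ℝ) (h : Spacetime → ℝ) (z : Spacetime) : ℝ :=
  ∫ w in strip T, h w * heatKernel (z - w)

/-- The coefficient `⟨h, ∂ᵢP(z - ·)⟩` of `Xᵢ`. -/
def heatGrad (T : ℝ) (h : Spacetime → ℝ) (i : Fin 3) (z : Spacetime) : ℝ :=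
  ∫ w in strip T, h w * heatDeriv i (z - w)

lemma heatPairing_zero (T : ℝ) (h : Spacetime → ℝ) : heatPairing T h 0 = heatValue T h := rfl

lemma heatPairing_spaceIndex (T : ℝ) (h : Spacetime → ℝ) (i : Fin 3) :
    heatPairing T h (spaceIndex i) = heatGrad T h i := by
  ext z
  rw [heatPairing, iterPartialD_spaceIndex, partialD_heatKernel, heatGrad]

lemma time_sub_le {z w : Spacetime} (hw : w ∈ strip T) : (z - w) 0 ≤ z 0 := by
  have := hw.1
  simp only [Pi.sub_apply]
  linarith

lemma enorm_heatValue_le (hκ : κ ≤ 2) {z : Spacetime} (hz : z ∈ strip T)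
    (hm : AEStronglyMeasurable h (volume.restrict (strip T))) :
    ‖heatValue T h z‖ₑ ≤
      ENNReal.ofReal (gaussianConst * z 0 ^ ((2 - κ) / 2)) * maximal κ T h z :=
  (enorm_integral_le_lintegral_enorm _).trans <|
    lintegral_mul_le_maximal_self hz.2
      (mul_nonneg gaussianConst_pos.le (Real.rpow_nonneg hz.1.le _)) hm
      fun _ hw => heatKernel_le_of_lt hκ (time_sub_le hw) hz.1

lemma enorm_heatGrad_le (hκ : κ ≤ 1) {z : Spacetime} (hz : z ∈ strip T)
    (hm : AEStronglyMeasurable h (volume.restrict (strip T))) (i : Fin 3) :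
    ‖heatGrad T h i z‖ₑ ≤
      ENNReal.ofReal (gaussianConst * z 0 ^ ((1 - κ) / 2)) * maximal κ T h z :=
  (enorm_integral_le_lintegral_enorm _).trans <|
    lintegral_mul_le_maximal_self hz.2
      (mul_nonneg gaussianConst_pos.le (Real.rpow_nonneg hz.1.le _)) hm
      fun _ hw => abs_heatDeriv_le_of_lt hκ (time_sub_le hw) hz.1 i

/-- A bound for an increment that is the pairing of `h` with an increment of the kernel, as long as
the integrals converge. -/
lemma enorm_le_of_increment {z z' : Spacetime} (hz : z 0 < T) (hz' : z' 0 < T) {c : ℝ}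
    (hc : 0 < c) (hm : AEStronglyMeasurable h (volume.restrict (strip T))) {k : Spacetime → ℝ}
    {x : ℝ} (hx : maximal κ T h z ≠ ⊤ → maximal κ T h z' ≠ ⊤ → x = ∫ w in strip T, h w * k w)
    (hk : ∀ w ∈ strip T, |k w| ≤ c * (majorant κ (z - w) + majorant κ (z' - w))) :
    ‖x‖ₑ ≤ ENNReal.ofReal c * (maximal κ T h z + maximal κ T h z') := by
  by_cases hfin : maximal κ T h z ≠ ⊤ ∧ maximal κ T h z' ≠ ⊤
  · rw [hx hfin.1 hfin.2]
    exact (enorm_integral_le_lintegral_enorm _).trans (lintegral_mul_le_maximal hz hz' hc.le hm hk)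
  -- If one of the two convolutions is infinite, so is the right-hand side, because c > 0. The
  -- increment need not be a convergent integral in this case.
  · have h1 : maximal κ T h z + maximal κ T h z' = ⊤ := by
      rw [ENNReal.add_eq_top]
      tauto
    rw [h1, ENNReal.mul_top (by simpa using hc)]
    exact le_top

variable {z a : Spacetime} {ρ : ℝ}

lemma enorm_heatValue_increment_le (hκ : 1 ≤ κ) (hκ2 : κ ≤ 2) (hz : z ∈ strip T)
    (hza : z + a ∈ strip T) (hρ : 0 < ρ) (ha : SmallShift ρ a)
    (hm : AEStronglyMeasurable h (volume.restrict (strip T))) :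
    ‖heatValue T h (z + a) - heatValue T h z‖ₑ ≤ ENNReal.ofReal (incrementConst * ρ ^ (2 - κ)) *
      (maximal κ T h z + maximal κ T h (z + a)) := by
  refine enorm_le_of_increment (k := fun w => heatKernel (z + a - w) - heatKernel (z - w)) hz.2
    hza.2 (mul_pos incrementConst_pos (Real.rpow_pos_of_pos hρ _)) hm (fun h1 h2 => ?_)
    fun w _ => ?_
  · simp only [mul_sub]
    rw [integral_sub (integrableOn_heatKernel hκ2 hza hm h2) (integrableOn_heatKernel hκ2 hz hm h1)]
    rfl
  · have := abs_heatKernel_increment_le (v := z - w) hρ ha hκ hκ2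
    rwa [sub_add_eq_add_sub, ← mul_assoc] at this

lemma enorm_heatGrad_increment_le (hκ : 0 ≤ κ) (hκ1 : κ ≤ 1) (hz : z ∈ strip T)
    (hza : z + a ∈ strip T) (hρ : 0 < ρ) (ha : SmallShift ρ a)
    (hm : AEStronglyMeasurable h (volume.restrict (strip T))) (i : Fin 3) :
    ‖heatGrad T h i (z + a) - heatGrad T h i z‖ₑ ≤
      ENNReal.ofReal (incrementConst * ρ ^ (1 - κ)) *
        (maximal κ T h z + maximal κ T h (z + a)) := by
  refine enorm_le_of_increment (k := fun w => heatDeriv i (z + a - w) - heatDeriv i (z - w)) hz.2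
    hza.2 (mul_pos incrementConst_pos (Real.rpow_pos_of_pos hρ _)) hm (fun h1 h2 => ?_)
    fun w _ => ?_
  · simp only [mul_sub]
    rw [integral_sub (integrableOn_heatDeriv hκ1 hza hm h2 i)
      (integrableOn_heatDeriv hκ1 hz hm h1 i)]
    rfl
  · have := abs_heatDeriv_increment_le (v := z - w) hρ ha hκ hκ1 i
    rwa [sub_add_eq_add_sub, ← mul_assoc] at this

lemma enorm_heatValue_taylor_le (hκ : 0 ≤ κ) (hκ1 : κ ≤ 1) (hz : z ∈ strip T)
    (hza : z + a ∈ strip T) (hρ : 0 < ρ) (ha : SmallShift ρ a)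
    (hm : AEStronglyMeasurable h (volume.restrict (strip T))) :
    ‖heatValue T h (z + a) - heatValue T h z - ∑ i : Fin 3, a i.succ * heatGrad T h i z‖ₑ ≤
      ENNReal.ofReal (incrementConst * ρ ^ (2 - κ)) *
        (maximal κ T h z + maximal κ T h (z + a)) := by
  refine enorm_le_of_increment (k := fun w => heatKernel (z + a - w) - heatKernel (z - w) -
    ∑ i : Fin 3, a i.succ * heatDeriv i (z - w)) hz.2
    hza.2 (mul_pos incrementConst_pos (Real.rpow_pos_of_pos hρ _)) hm (fun h1 h2 => ?_)
    fun w _ => ?_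
  · have hκ2 : κ ≤ 2 := by linarith
    have hg := fun i => (integrableOn_heatDeriv hκ1 hz hm h1 i).const_mul (a i.succ)
    have hd : Integrable (fun w => h w * heatKernel (z + a - w) - h w * heatKernel (z - w))
        (volume.restrict (strip T)) :=
      (integrableOn_heatKernel hκ2 hza hm h2).sub (integrableOn_heatKernel hκ2 hz hm h1)
    simp only [mul_sub, Finset.mul_sum, mul_left_comm (h _)]
    rw [integral_sub hd (integrable_finsetSum _ fun i _ => hg i),
      integral_sub (integrableOn_heatKernel hκ2 hza hm h2) (integrableOn_heatKernel hκ2 hz hm h1),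
      integral_finsetSum _ fun i _ => hg i]
    simp only [integral_const_mul]
    rfl
  · have := abs_heatKernel_taylor_increment_le (v := z - w) hρ ha hκ hκ1
    rwa [sub_add_eq_add_sub, ← mul_assoc] at this

/-! ### Measurability and periodicity of the heat pairings -/

lemma aemeasurable_pairing {k : Spacetime → ℝ} (hk : Measurable k)
    (hm : AEStronglyMeasurable h (volume.restrict (strip T))) :
    AEMeasurable (fun z => ∫ w in strip T, h w * k (z - w)) (volume.restrict (strip T)) := by
  have : AEStronglyMeasurable (fun p : Spacetime × Spacetime => h p.2 * k (p.1 - p.2))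
      ((volume.restrict (strip T)).prod (volume.restrict (strip T))) :=
    hm.comp_snd.mul (hk.comp (by fun_prop)).aestronglyMeasurable
  exact this.integral_prod_right'.aemeasurable

lemma pairing_periodic (hper : IsPeriodic T h) (k : Spacetime → ℝ) (z : Spacetime)
    (n : Fin 3 → ℤ) : ∫ w in strip T, h w * k (z + latticeShift n - w) =
      ∫ w in strip T, h w * k (z - w) := by
  rw [← integral_indicator (measurableSet_strip T), ← integral_indicator (measurableSet_strip T),
    ← integral_add_right_eq_self _ (latticeShift n)]
  congr 1 with w
  by_cases hw : w ∈ strip T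
  · rw [indicator_of_mem hw, indicator_of_mem ((add_latticeShift_mem_strip n).2 hw), hper w hw n,
      add_sub_add_right_eq_sub]
  · rw [indicator_of_notMem hw, indicator_of_notMem (mt (add_latticeShift_mem_strip n).1 hw)]

/-! ### From pointwise bounds to bounds in `L²` -/

lemma ENNReal_add_sq_le (x y : ℝ≥0∞) : (x + y) ^ 2 ≤ 2 * (x ^ 2 + y ^ 2) := by
  have := ENNReal.rpow_add_le_mul_rpow_add_rpow x y (p := 2) one_le_two
  norm_num at this
  exact this

/-- The right-hand side does not depend on a, which gives the supremum over all shifts at once. The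
shifted set may leave the unit cell; periodicity of `maximal` makes this irrelevant. -/
lemma eLpNorm_le_of_enorm_le (hper : IsPeriodic T h)
    (hm : AEStronglyMeasurable h (volume.restrict (strip T))) {S : Set Spacetime}
    (hS : MeasurableSet S) (hSc : S ⊆ unitCell) (a : Spacetime) {c : ℝ≥0∞} {g : Spacetime → ℝ}
    (hg : ∀ z ∈ S, ‖g z‖ₑ ≤ c * (maximal κ T h z + maximal κ T h (z + a))) :
    eLpNorm g 2 (volume.restrict S) ≤
      (c ^ 2 * (4 * ∫⁻ z in unitCell, maximal κ T h z ^ 2)) ^ (1 / 2 : ℝ) := by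
  have hM := aemeasurable_maximal (κ := κ) hm
  have hMa : AEMeasurable fun z => maximal κ T h (z + a) :=
    hM.comp_quasiMeasurePreserving (measurePreserving_add_right volume a).quasiMeasurePreserving
  rw [eLpNorm_eq_lintegral_rpow_enorm_toReal two_ne_zero ENNReal.ofNat_ne_top]
  simp only [ENNReal.toReal_ofNat, ENNReal.rpow_two]
  gcongr
  calc ∫⁻ z in S, ‖g z‖ₑ ^ 2
      ≤ ∫⁻ z in S, c ^ 2 * (2 * (maximal κ T h z ^ 2 + maximal κ T h (z + a) ^ 2)) := by
        refine setLIntegral_mono' hS fun z hz => ?_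
        calc ‖g z‖ₑ ^ 2 ≤ (c * (maximal κ T h z + maximal κ T h (z + a))) ^ 2 := by
              gcongr; exact hg z hz
          _ ≤ _ := by rw [mul_pow]; gcongr; exact ENNReal_add_sq_le _ _
    _ ≤ ∫⁻ z in unitCell, c ^ 2 * (2 * (maximal κ T h z ^ 2 + maximal κ T h (z + a) ^ 2)) :=
        lintegral_mono_set hSc
    _ = c ^ 2 * (4 * ∫⁻ z in unitCell, maximal κ T h z ^ 2) := by
        have h2 : AEMeasurable (fun z => maximal κ T h z ^ 2) (volume.restrict unitCell) :=
          (hM.pow_const 2).restrict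
        have h3 : AEMeasurable (fun z => maximal κ T h (z + a) ^ 2) (volume.restrict unitCell) :=
          (hMa.pow_const 2).restrict
        have h4 : AEMeasurable (fun z => maximal κ T h z ^ 2 + maximal κ T h (z + a) ^ 2)
          (volume.restrict unitCell) := h2.add h3
        rw [lintegral_const_mul'' _ (h4.const_mul 2), lintegral_const_mul'' _ h4,
          lintegral_add_left' h2, lintegral_unitCell_add (fun z => maximal κ T h z ^ 2)
          (fun z n => by rw [maximal_periodic hper]) a, ← two_mul, ← mul_assoc 2 2]
        norm_num

lemma enorm_div_le {L D C : ℝ} {Y : ℝ≥0∞} (hC : 0 ≤ C) (hD : 0 < D)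
    (hL : ‖L‖ₑ ≤ ENNReal.ofReal (C * D) * Y) : ‖L / D‖ₑ ≤ ENNReal.ofReal C * Y := by
  rw [div_eq_mul_inv, enorm_mul, Real.enorm_eq_ofReal (inv_nonneg.2 hD.le)]
  calc _ ≤ ENNReal.ofReal (C * D) * Y * ENNReal.ofReal D⁻¹ := by gcongr
    _ = ENNReal.ofReal (C * D * D⁻¹) * Y := by
      rw [ENNReal.ofReal_mul (show 0 ≤ C * D by positivity)]; ring
    _ = _ := by rw [mul_inv_cancel_right₀ hD.ne']

lemma enorm_sum_le_three {f : Fin 3 → ℝ} {B : ℝ} {Y : ℝ≥0∞}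
    (hf : ∀ i, ‖f i‖ₑ ≤ ENNReal.ofReal B * Y) :
    ‖∑ i, |f i|‖ₑ ≤ ENNReal.ofReal (3 * B) * Y := by
  refine (enorm_sum_le _ _).trans ?_
  calc ∑ i, ‖|f i|‖ₑ ≤ ∑ i : Fin 3, ENNReal.ofReal B * Y :=
        Finset.sum_le_sum fun i _ => by simpa using hf i
    _ = _ := by
      rw [ENNReal.ofReal_mul (by norm_num), Finset.sum_const, Finset.card_univ, Fintype.card_fin,
        nsmul_eq_mul, ENNReal.ofReal_ofNat, mul_assoc]
      rfl

end

/-! ### The lift as a modelled distribution -/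

/-- The polynomial `a 1 + ∑ᵢ bᵢ Xᵢ` over the spatial coordinates. -/
def affinePoly (a : ℝ) (b : Fin 3 → ℝ) : ModelSpace :=
  a • polyVec 0 + ∑ i, b i • polyVec (spaceIndex i)

lemma levelNorm_affinePoly_le (θ ζ a : ℝ) (b : Fin 3 → ℝ) :
    levelNorm θ ζ (affinePoly a b) ≤
      (if ζ = 0 then |a| else 0) + if ζ = 1 then ∑ i, |b i| else 0 := by
  refine (levelNorm_add_le ..).trans (add_le_add ?_ ((levelNorm_sum_le ..).trans ?_))
  · simp [levelNorm_smul_polyVec, deg_zero, eq_comm]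
  · simp only [levelNorm_smul_polyVec, deg_spaceIndex, Nat.cast_one, eq_comm (a := (1 : ℝ))]
    split_ifs <;> simp

lemma projBelow_add (θ γ : ℝ) (τ τ' : ModelSpace) :
    projBelow θ γ (τ + τ') = projBelow θ γ τ + projBelow θ γ τ' := Finsupp.filter_add

lemma projBelow_smul_polyVec (θ γ c : ℝ) (k : MultiIndex) :
    projBelow θ γ (c • polyVec k) = (if (k.deg : ℝ) < γ then c else 0) • polyVec k := by
  have h : ∀ c : ℝ, c • polyVec k = Finsupp.single (polySymbol k) c := by simp [polyVec]
  have hk : (polySymbol k).1.hom θ = k.deg := Symb.hom_Xpow θ k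
  rw [h, h, projBelow]
  split_ifs with hγ
  · exact Finsupp.filter_single_of_pos _ (by rwa [hk])
  · rw [Finsupp.filter_single_of_neg _ (by rwa [hk]), Finsupp.single_zero]

lemma projBelow_affinePoly (θ γ a : ℝ) (b : Fin 3 → ℝ) :
    projBelow θ γ (affinePoly a b) =
      affinePoly (if 0 < γ then a else 0) fun i => if 1 < γ then b i else 0 := by
  simp only [affinePoly, Fin.sum_univ_three, projBelow_add, projBelow_smul_polyVec, deg_zero,
    deg_spaceIndex, Nat.cast_zero, Nat.cast_one]

/-- With the value and gradient of F as coefficients, the component of 1 becomes the first-order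
Taylor remainder of F, and those of Xᵢ the increments of ∂ᵢF. -/
lemma affinePoly_sub_Gam {θ : ℝ} {r : ℕ} (M : Model θ r) (z z' : Spacetime) (x a : ℝ)
    (y b : Fin 3 → ℝ) : affinePoly x y - (M.Gam z z').1 (affinePoly a b) =
      affinePoly (x - a - ∑ i : Fin 3, (z i.succ - z' i.succ) * b i) fun i => y i - b i := by
  simp only [affinePoly, Fin.sum_univ_three, map_add, map_smul, Gam_polyVec_zero,
    Gam_polyVec_spaceIndex]
  module

lemma heatLift_eq (T : ℝ) (h : Spacetime → ℝ) (z : Spacetime) :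
    heatLift T h z = affinePoly (heatValue T h z) fun i => heatGrad T h i z := by
  rw [heatLift, sum_smallIndices, affinePoly, heatPairing_zero, fact_zero]
  simp only [heatPairing_spaceIndex, fact_spaceIndex, Nat.cast_one, div_one]

lemma belowLevel_projBelow (θ γ : ℝ) (τ : ModelSpace) : BelowLevel θ γ (projBelow θ γ τ) := by
  intro σ hσ
  rw [projBelow, Finsupp.support_filter, Finset.mem_filter] at hσ
  exact hσ.2

lemma enorm_levelNorm_le {θ ζ x : ℝ} {τ : ModelSpace} (h : levelNorm θ ζ τ ≤ |x|) :
    ‖levelNorm θ ζ τ‖ₑ ≤ ‖x‖ₑ := by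
  rw [Real.enorm_eq_ofReal (levelNorm_nonneg _ _ _), Real.enorm_eq_ofReal_abs]
  exact ENNReal.ofReal_le_ofReal h

section

variable {κ T : ℝ} {h : Spacetime → ℝ}

lemma enorm_levelNorm_affinePoly_div_le (θ ζ : ℝ) {a : ℝ} {b : Fin 3 → ℝ} {C D : ℝ} {Y : ℝ≥0∞}
    (hC : 0 ≤ C) (hD : 0 < D) (ha : ζ = 0 → ‖a‖ₑ ≤ ENNReal.ofReal (C * D) * Y)
    (hb : ζ = 1 → ∀ i, ‖b i‖ₑ ≤ ENNReal.ofReal (C * D) * Y) :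
    ‖levelNorm θ ζ (affinePoly a b) / D‖ₑ ≤ ENNReal.ofReal (3 * C) * Y := by
  have hl := levelNorm_affinePoly_le θ ζ a b
  refine enorm_div_le (by positivity) hD ?_
  by_cases h0 : ζ = 0
  · subst h0
    rw [if_pos rfl, if_neg zero_ne_one, add_zero] at hl
    refine (enorm_levelNorm_le hl).trans ((ha rfl).trans ?_)
    gcongr
    linarith
  by_cases h1 : ζ = 1
  · subst h1
    rw [if_pos rfl, if_neg one_ne_zero, zero_add] at hl
    refine (enorm_levelNorm_le (hl.trans (le_abs_self _))).trans ?_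
    rw [mul_assoc 3]
    exact enorm_sum_le_three (hb rfl)
  · rw [if_neg h0, if_neg h1, add_zero] at hl
    rw [le_antisymm hl (levelNorm_nonneg _ _ _), enorm_zero]
    exact zero_le

lemma enorm_levelNorm_heatLift_le (θ : ℝ) {ζ : ℝ} (hζ : ζ < 2 - κ) {z : Spacetime}
    (hz : z ∈ strip T) (hm : AEStronglyMeasurable h (volume.restrict (strip T))) :
    ‖levelNorm θ ζ (projBelow θ (2 - κ) (heatLift T h z)) / z 0 ^ ((2 - κ - ζ) / 2)‖ₑ ≤
      ENNReal.ofReal (3 * gaussianConst) * maximal κ T h z := by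
  rw [heatLift_eq, projBelow_affinePoly]
  refine enorm_levelNorm_affinePoly_div_le θ ζ gaussianConst_pos.le
    (Real.rpow_pos_of_pos hz.1 _) ?_ ?_
  · rintro rfl
    rw [if_pos hζ, sub_zero]
    exact enorm_heatValue_le (by linarith) hz hm
  · rintro rfl i
    rw [if_pos hζ, show 2 - κ - 1 = 1 - κ by ring]
    exact enorm_heatGrad_le (by linarith) hz hm i

lemma enorm_levelNorm_heatLift_increment_le {θ : ℝ} {r : ℕ} (M : Model θ r) (hκ : 0 ≤ κ) {ζ : ℝ}
    (hζ : ζ < 2 - κ) {z a : Spacetime} (hz : z ∈ strip T) (hza : z + a ∈ strip T)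
    (hm : AEStronglyMeasurable h (volume.restrict (strip T))) :
    ‖levelNorm θ ζ (projBelow θ (2 - κ) (heatLift T h (z + a)) -
        (M.Gam (z + a) z).1 (projBelow θ (2 - κ) (heatLift T h z))) /
          (scaledNorm a ^ (2 - κ - ζ) * z 0 ^ ((2 - κ - (2 - κ)) / 2))‖ₑ ≤
      ENNReal.ofReal (3 * incrementConst) * (maximal κ T h z + maximal κ T h (z + a)) := by
  -- Here η = γ, so the time weight is t^0 = 1.
  rw [sub_self (2 - κ), zero_div, Real.rpow_zero, mul_one]
  rcases (scaledNorm_nonneg a).eq_or_lt with hρ | hρ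
  -- For a shift of size zero the denominator vanishes and the quotient is 0 by convention.
  · rw [← hρ, Real.zero_rpow (by linarith), div_zero, enorm_zero]
    exact zero_le
  have ha := smallShift_scaledNorm a
  rw [heatLift_eq, heatLift_eq, projBelow_affinePoly, projBelow_affinePoly, affinePoly_sub_Gam]
  refine enorm_levelNorm_affinePoly_div_le θ ζ incrementConst_pos.le
    (Real.rpow_pos_of_pos hρ _) ?_ ?_
  · rintro rfl
    rw [if_pos hζ, if_pos hζ, sub_zero]
    -- For κ < 1 the gradient is present and subtracts the linear term; for κ ≥ 1 its coefficient
    -- was projected to 0 and only the plain increment remains.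
    by_cases h1 : 1 < 2 - κ
    · simp only [if_pos h1, Pi.add_apply, add_sub_cancel_left]
      exact enorm_heatValue_taylor_le hκ (by linarith) hz hza hρ ha hm
    · simp only [if_neg h1, mul_zero, Finset.sum_const_zero, sub_zero]
      exact enorm_heatValue_increment_le (by linarith) (by linarith) hz hza hρ ha hm
  · rintro rfl i
    rw [if_pos hζ, if_pos hζ, show 2 - κ - 1 = 1 - κ by ring]
    exact enorm_heatGrad_increment_le hκ (by linarith) hz hza hρ ha hm i

lemma aemeasurable_heatLift (θ γ : ℝ) (hm : AEStronglyMeasurable h (volume.restrict (strip T)))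
    (σ : symbols) :
    AEMeasurable (fun z => projBelow θ γ (heatLift T h z) σ) (volume.restrict (strip T)) := by
  have h0 : AEMeasurable (heatValue T h) (volume.restrict (strip T)) :=
    aemeasurable_pairing measurable_heatKernel hm
  have h1 : ∀ i, AEMeasurable (heatGrad T h i) (volume.restrict (strip T)) := fun i =>
    aemeasurable_pairing (measurable_heatDeriv i) hm
  simp only [heatLift_eq, projBelow_affinePoly]
  simp only [affinePoly, Fin.sum_univ_three, Finsupp.add_apply, Finsupp.smul_apply, smul_eq_mul]
  have h0' : AEMeasurable (fun z => if 0 < γ then heatValue T h z else 0)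
      (volume.restrict (strip T)) := by
    split_ifs
    exacts [h0, aemeasurable_const]
  have h1' : ∀ i, AEMeasurable (fun z => if 1 < γ then heatGrad T h i z else 0)
      (volume.restrict (strip T)) := fun i => by
    split_ifs
    exacts [h1 i, aemeasurable_const]
  exact (h0'.mul_const _).add ((((h1' 0).mul_const _).add ((h1' 1).mul_const _)).add
    ((h1' 2).mul_const _))

lemma heatLift_periodic (hper : IsPeriodic T h) (z : Spacetime) (n : Fin 3 → ℤ) :
    heatLift T h (z + latticeShift n) = heatLift T h z := by
  rw [heatLift_eq, heatLift_eq, heatValue, pairing_periodic hper]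
  simp only [heatGrad, pairing_periodic hper]
  rfl

lemma ae_integrableOn_heatKernel (hper : IsPeriodic T h)
    (hL2 : MemLp h 2 (volume.restrict (torusSlab 0 T))) :
    ∀ᵐ z ∂(volume.restrict (strip T)), ∀ k ∈ smallIndices,
      IntegrableOn (fun w => h w * iterPartialD k heatKernel (z - w)) (strip T) := by
  have hm := aestronglyMeasurable_strip hper hL2.1
  -- Absolute convergence does not involve the κ of the modelled distribution; the exponent 1 is
  -- admissible for both P and its gradient.
  have h1 : ∀ᵐ z ∂(volume.restrict unitCell), maximal 1 T h z ^ 2 < ⊤ :=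
    ae_lt_top' ((aemeasurable_maximal hm).pow_const 2).restrict
      (lintegral_maximal_sq_lt_top one_pos hper hL2).ne
  have h2 := ae_strip_of_ae_unitCell (T := T)
    (fun z n => by rw [maximal_periodic hper]) h1
  filter_upwards [h2, ae_restrict_mem (measurableSet_strip T)] with z hz hzT k hk
  have hfin : maximal 1 T h z ≠ ⊤ := fun e => by simp [e] at hz
  rw [smallIndices_eq, Finset.mem_insert, Finset.mem_image] at hk
  rcases hk with rfl | ⟨i, -, rfl⟩
  · exact integrableOn_heatKernel one_le_two hzT hm hfin
  · rw [iterPartialD_spaceIndex, partialD_heatKernel]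
    exact integrableOn_heatDeriv le_rfl hzT hm hfin i

lemma isModelled_heatLift {θ : ℝ} {r : ℕ} (M : Model θ r) (hκ : 0 < κ) (hper : IsPeriodic T h)
    (hL2 : MemLp h 2 (volume.restrict (torusSlab 0 T))) :
    IsModelled M (2 - κ) (2 - κ) T 2 fun z => projBelow θ (2 - κ) (heatLift T h z) := by
  have hm := aestronglyMeasurable_strip hper hL2.1
  have hfin : ∀ c : ℝ, (ENNReal.ofReal c ^ 2 * (4 * ∫⁻ z in unitCell, maximal κ T h z ^ 2)) ^
      (1 / 2 : ℝ) < ⊤ := fun c =>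
    ENNReal.rpow_lt_top_of_nonneg (by norm_num) (ENNReal.mul_lt_top
      (ENNReal.pow_lt_top ENNReal.ofReal_lt_top) (ENNReal.mul_lt_top ENNReal.ofNat_lt_top
        (lintegral_maximal_sq_lt_top hκ hper hL2))).ne
  refine ⟨aemeasurable_heatLift θ _ hm, fun z _ n => by simp only [heatLift_periodic hper],
    fun z _ => belowLevel_projBelow _ _ _, fun ζ _ hζ => ?_, fun ζ _ hζ => ?_⟩
  -- The local bound uses the shift a = 0, at the cost of a harmless second copy of `maximal`.
  · refine (eLpNorm_le_of_enorm_le hper hm (measurableSet_torusSlab 0 T)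
      (by rw [torusSlab_eq]; exact inter_subset_right) 0 fun z hz => ?_).trans_lt
      (hfin (3 * gaussianConst))
    rw [torusSlab_zero_eq] at hz
    refine (enorm_levelNorm_heatLift_le θ hζ hz.1 hm).trans ?_
    gcongr
    exact le_self_add
  · refine (iSup₂_le fun a _ => ?_).trans_lt (hfin (3 * incrementConst))
    refine eLpNorm_le_of_enorm_le hper hm (measurableSet_torusSlab _ _)
      (by rw [torusSlab_eq]; exact inter_subset_right) a fun z hz => ?_
    -- Since |a₀| ≤ |a|², the margins 3|a|² and |a|² in the time interval keep both z and z + a in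
    -- the strip.
    have ha := abs_le.1 (smallShift_scaledNorm a).1
    have hρ := sq_nonneg (scaledNorm a)
    obtain ⟨h1, h2, -⟩ := hz
    have hza : (z + a) 0 = z 0 + a 0 := rfl
    refine enorm_levelNorm_heatLift_increment_le M hκ.le hζ ⟨?_, ?_⟩ ⟨?_, ?_⟩ hm <;> linarith

end

end ConvShift

end

theorem lemma3p10 (θ : ℝ) (r : ℕ) (hr : 5 / 2 < (r : ℝ)) (M : ConvShift.Model θ r)
    (T : ℝ) (hT : 0 < T) (κ : ℝ) (hκ : 0 < κ) (h : ConvShift.Spacetime → ℝ)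
    (hper : ConvShift.IsPeriodic T h)
    (hL2 : MemLp h 2 (volume.restrict (ConvShift.torusSlab 0 T))) :
    (∀ᵐ z ∂(volume.restrict (ConvShift.strip T)), ∀ k ∈ ConvShift.smallIndices,
      IntegrableOn (fun w => h w * ConvShift.iterPartialD k ConvShift.heatKernel (z - w))
        (ConvShift.strip T)) ∧
    ConvShift.IsModelled M (2 - κ) (2 - κ) T 2
      (fun z => ConvShift.projBelow θ (2 - κ) (ConvShift.heatLift T h z)) :=
  ⟨ConvShift.ae_integrableOn_heatKernel hper hL2, ConvShift.isModelled_heatLift M hκ hper hL2⟩
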